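/- Let $S=\mathbb C\cup\{\infty\}$ be the Riemann sphere, let $p_1\neq p_2$ be two points of $S$, let $\lambda_1,\lambda_2>-1$ be real numbers, and let $\beta=\lambda_1p_1+\lambda_2p_2$ (a point with $\lambda_i=0$ does not belong to the support of $\beta$). Then there exists a Ricci soliton metric in the conformal class $(S,\beta)$, and it can be chosen rotationally symmetric. That is, there is a smooth Riemannian metric $g$ on $S\setminus\operatorname{supp}\beta$, compatible with the conformal structure of $S$, such that: (1) At each $p_i\in\operatorname{supp}\beta$, $g$ has a conical singularity of order $\lambda_i$: in a conformal coordinate $z$ near $p_i$ with $z(p_i)=0$ one has $g=\rho(z)|z|^{2\lambda_i}|dz|^2$ with $\rho$ continuous and positive near $0$. Moreover, for all $l\in\mathbb N$ and $0<\alpha<1$, $g$ is a weighted $C^{l,\alpha}$ cone metric there: in a conformal coordinate $z=re^{i\theta}$ centred at $p_i$ one has $g=e^{2u}|z|^{2\lambda_i}|dz|^2$ near $p_i$, where the functions $F_k(s,\theta)=u(r,\theta)$, with $s=2^k\,\frac{r^{\lambda_i+1}}{\lambda_i+1}\in(\tfrac12,2)$ and $\theta\in S^1$, are bounded in the Hölder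 space $C^{l,\alpha}((\tfrac12,2)\times S^1)$ uniformly in all sufficiently large $k\in\mathbb N$. (2) $g$ is a gradient shrinking Ricci soliton: there is a function $f$, continuous on $S$ and smooth on $S\setminus\operatorname{supp}\beta$, such that $$\tfrac12 R\,g_{ij}-g_{ij}=\nabla_{ij}f\qquad\text{on }S\setminus\operatorname{supp}\beta,$$ where $R$ is the scalar curvature of $g$ and $\nabla_{ij}f$ is the Hessian of $f$ with respect to $g$. (3) $g$ is rotationally symmetric about $p_1$ and $p_2$: in some conformal coordinate $z:S\setminus\{p_2\}\to\mathbb C$ that is bijective onto $\mathbb C$, with $z(p_1)=0$, one has $g=h(|z|)\,|dz|^2$ for $z\neq0$. -/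

import Mathlib

open Set Filter Topology
open scoped Manifold ContDiff NNReal

noncomputable section

/-! ### The Riemann sphere -/

/-- The Riemann sphere `ℂ ∪ {∞}`. -/
abbrev RiemannSphere : Type := OnePoint ℂ

namespace RiemannSphere

/-- The map `z ↦ 1 / z` of the Riemann sphere, exchanging `0` and `∞`. -/
def inversionFun : RiemannSphere → RiemannSphere
  | none => ((0 : ℂ) : OnePoint ℂ)
  | some z => if z = 0 then OnePoint.infty else ((z⁻¹ : ℂ) : OnePoint ℂ)

lemma inversionFun_infty : inversionFun OnePoint.infty = ((0 : ℂ) : OnePoint ℂ) := rfl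

lemma inversionFun_coe (z : ℂ) : inversionFun (z : OnePoint ℂ) =
    if z = 0 then OnePoint.infty else ((z⁻¹ : ℂ) : OnePoint ℂ) := rfl

lemma inversionFun_inversionFun (x : RiemannSphere) : inversionFun (inversionFun x) = x := by
  induction x using OnePoint.rec with
  | infty => simp [inversionFun_infty, inversionFun_coe]
  | coe z =>
    by_cases hz : z = 0
    · simp [inversionFun_infty, inversionFun_coe, hz]
    · simp [inversionFun_coe, hz]

lemma continuous_inversionFun : Continuous inversionFun := by
  rw [continuous_iff_continuousAt]
  intro x
  induction x using OnePoint.rec with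
  | infty =>
    rw [OnePoint.continuousAt_infty', inversionFun_infty, coclosedCompact_eq_cocompact,
      ← Metric.cobounded_eq_cocompact]
    have h : Tendsto (fun z : ℂ => ((z⁻¹ : ℂ) : OnePoint ℂ)) (Bornology.cobounded ℂ)
        (𝓝 ((0 : ℂ) : OnePoint ℂ)) :=
      (OnePoint.continuous_coe.tendsto 0).comp Filter.tendsto_inv₀_cobounded
    refine h.congr' ?_
    filter_upwards [Bornology.eventually_ne_cobounded (0 : ℂ)] with z hz
    simp [inversionFun_coe, hz]
  | coe z =>
    rw [OnePoint.continuousAt_coe]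
    by_cases hz : z = 0
    · subst hz
      rw [← continuousWithinAt_compl_self]
      have h : Tendsto (fun z : ℂ => ((z⁻¹ : ℂ) : OnePoint ℂ)) (𝓝[≠] 0)
          (𝓝 (OnePoint.infty : OnePoint ℂ)) := by
        have h1 := OnePoint.tendsto_coe_infty (X := ℂ)
        rw [coclosedCompact_eq_cocompact, ← Metric.cobounded_eq_cocompact] at h1
        exact h1.comp Filter.tendsto_inv₀_nhdsNE_zero
      have h2 : (inversionFun ∘ ((↑) : ℂ → OnePoint ℂ)) 0 = OnePoint.infty := by
        simp [inversionFun_coe]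
      rw [ContinuousWithinAt, h2]
      refine h.congr' ?_
      filter_upwards [self_mem_nhdsWithin] with w hw
      have hw' : w ≠ 0 := hw
      simp [inversionFun_coe, hw']
    · have h : ContinuousAt (fun w : ℂ => ((w⁻¹ : ℂ) : OnePoint ℂ)) z :=
        OnePoint.continuous_coe.continuousAt.comp (continuousAt_inv₀ hz)
      refine h.congr ?_
      filter_upwards [isOpen_ne.mem_nhds hz] with w hw
      have hw' : w ≠ 0 := hw
      simp [inversionFun_coe, hw']

/-- `z ↦ 1 / z` as a homeomorphism of the Riemann sphere. -/
def inversion : RiemannSphere ≃ₜ RiemannSphere where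
  toFun := inversionFun
  invFun := inversionFun
  left_inv := inversionFun_inversionFun
  right_inv := inversionFun_inversionFun
  continuous_toFun := continuous_inversionFun
  continuous_invFun := continuous_inversionFun

/-- The affine coordinate `z`, defined on the complement of `∞`. -/
def coordZero : OpenPartialHomeomorph RiemannSphere ℂ :=
  ((OnePoint.isOpenEmbedding_coe (X := ℂ)).toOpenPartialHomeomorph _).symm

/-- The coordinate `1 / z`, defined on the complement of `0`. -/
def coordInfty : OpenPartialHomeomorph RiemannSphere ℂ :=
  inversion.toOpenPartialHomeomorph ≫ₕ coordZero

lemma coordZero_source : coordZero.source = {OnePoint.infty}ᶜ := by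
  simp [coordZero, OnePoint.compl_infty]

lemma coordInfty_source : coordInfty.source = {((0 : ℂ) : OnePoint ℂ)}ᶜ := by
  ext x
  simp only [coordInfty, OpenPartialHomeomorph.trans_source, coordZero_source]
  induction x using OnePoint.rec with
  | infty => simp [inversion, inversionFun_infty]
  | coe z => by_cases hz : z = 0 <;> simp [inversion, inversionFun_coe, hz]

/-- The standard atlas of the Riemann sphere. -/
instance : ChartedSpace ℂ RiemannSphere where
  atlas := {coordZero, coordInfty}
  chartAt x := open Classical in if x = OnePoint.infty then coordInfty else coordZero
  mem_chart_source x := by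
    by_cases hx : x = OnePoint.infty
    · simp [hx, coordInfty_source]
    · simp [hx, coordZero_source]
  chart_mem_atlas x := by
    by_cases hx : x = OnePoint.infty <;> simp [hx]

lemma coordZero_coe (z : ℂ) : coordZero (z : OnePoint ℂ) = z :=
  (OnePoint.isOpenEmbedding_coe (X := ℂ)).toOpenPartialHomeomorph_left_inv

lemma coordZero_symm (z : ℂ) : coordZero.symm z = (z : OnePoint ℂ) := rfl

lemma coordInfty_symm (z : ℂ) : coordInfty.symm z = inversionFun (z : OnePoint ℂ) := rfl

lemma coordInfty_apply (x : RiemannSphere) : coordInfty x = coordZero (inversionFun x) := rfl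

/-- The Riemann sphere is a Riemann surface. -/
instance : IsManifold 𝓘(ℂ) ω RiemannSphere := by
  apply isManifold_of_contDiffOn
  have key : ∀ e e' : OpenPartialHomeomorph RiemannSphere ℂ,
      (∀ z ∈ (e.symm ≫ₕ e').source, z ≠ 0 ∧ e' (e.symm z) = z⁻¹) →
      ContDiffOn ℂ ω (𝓘(ℂ) ∘ (e.symm ≫ₕ e') ∘ 𝓘(ℂ).symm)
        (𝓘(ℂ).symm ⁻¹' (e.symm ≫ₕ e').source ∩ range 𝓘(ℂ)) := by
    intro e e' h
    have h0 : ContDiffOn ℂ ω (fun z : ℂ => z⁻¹) {z | z ≠ 0} :=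
      fun z hz => (contDiffAt_inv ℂ hz).contDiffWithinAt
    refine (h0.mono ?_).congr ?_
    · intro z hz
      exact (h z (by simpa using hz)).1
    · intro z hz
      exact (h z (by simpa using hz)).2
  have self : ∀ e : OpenPartialHomeomorph RiemannSphere ℂ,
      ContDiffOn ℂ ω (𝓘(ℂ) ∘ (e.symm ≫ₕ e) ∘ 𝓘(ℂ).symm)
        (𝓘(ℂ).symm ⁻¹' (e.symm ≫ₕ e).source ∩ range 𝓘(ℂ)) := by
    intro e
    refine contDiffOn_id.congr ?_
    intro z hz
    have hz' : z ∈ (e.symm ≫ₕ e).source := by simpa using hz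
    exact e.right_inv (by simpa using hz'.1)
  rintro e e' (rfl | rfl) (rfl | rfl)
  · exact self _
  · apply key
    intro z hz
    have h1 := hz.2
    rw [mem_preimage, coordInfty_source] at h1
    have hz0 : z ≠ 0 := by
      rintro rfl
      exact h1 rfl
    refine ⟨hz0, ?_⟩
    rw [coordZero_symm, coordInfty_apply, inversionFun_coe, if_neg hz0, coordZero_coe]
  · apply key
    intro z hz
    have h1 := hz.2
    rw [mem_preimage, coordZero_source] at h1
    have hz0 : z ≠ 0 := by
      rintro rfl
      apply h1
      change inversionFun ((0 : ℂ) : OnePoint ℂ) = OnePoint.infty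
      simp [inversionFun_coe]
    refine ⟨hz0, ?_⟩
    rw [coordInfty_symm, inversionFun_coe, if_neg hz0, coordZero_coe]
  · exact self _

end RiemannSphere

/-! ### Riemannian geometry in local coordinates -/

namespace LocalGeometry

/-- `∂F/∂x` (for `i = 0`) and `∂F/∂y` (for `i = 1`), where `z = x + i y`. -/
def pd (i : Fin 2) (F : ℂ → ℝ) (z : ℂ) : ℝ := fderiv ℝ F z (![1, Complex.I] i)

/-- The Christoffel symbols `Γᵏᵢⱼ` of the metric `Gᵢⱼ dxⁱ dxʲ`. -/
def christoffel (G : ℂ → Matrix (Fin 2) (Fin 2) ℝ) (k i j : Fin 2) (z : ℂ) : ℝ :=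
  (1 / 2) * ∑ l, (G z)⁻¹ k l *
    (pd i (fun w => G w j l) z + pd j (fun w => G w i l) z - pd l (fun w => G w i j) z)

/-- The Ricci curvature `Rⱼₖ` of the metric `Gᵢⱼ dxⁱ dxʲ`. -/
def ricci (G : ℂ → Matrix (Fin 2) (Fin 2) ℝ) (j k : Fin 2) (z : ℂ) : ℝ :=
  ∑ i, (pd i (christoffel G i j k) z - pd j (christoffel G i i k) z
    + ∑ p, (christoffel G i i p z * christoffel G p j k z
      - christoffel G i j p z * christoffel G p i k z))

/-- The scalar curvature of the metric `Gᵢⱼ dxⁱ dxʲ`. -/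
def scalarCurvature (G : ℂ → Matrix (Fin 2) (Fin 2) ℝ) (z : ℂ) : ℝ :=
  ∑ j, ∑ k, (G z)⁻¹ j k * ricci G j k z

/-- The components `∇ᵢⱼ F` of the Hessian of `F` for the metric `Gᵢⱼ dxⁱ dxʲ`. -/
def hessian (G : ℂ → Matrix (Fin 2) (Fin 2) ℝ) (F : ℂ → ℝ) (i j : Fin 2) (z : ℂ) : ℝ :=
  pd i (pd j F) z - ∑ k, christoffel G k i j z * pd k F z

end LocalGeometry

/-! ### Conformal metrics with conical singularities on a Riemann surface -/

section Surface

variable (S : Type*) [TopologicalSpace S] [ChartedSpace ℂ S]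

/-- The conformal coordinates of a Riemann surface: the charts of its maximal holomorphic atlas. -/
abbrev conformalCoordinates : Set (OpenPartialHomeomorph S ℂ) :=
  IsManifold.maximalAtlas 𝓘(ℂ) ω S

/-- A smooth Riemannian metric on `S \ P`, compatible with the conformal structure of `S`: in each
conformal coordinate `z = e(x)` it is `density e z * |dz|²` with a smooth positive density, and
these expressions agree where two coordinates overlap. Values of `density` outside the domain
described here play no role. -/
structure ConformalMetric (P : Set S) where
  density : OpenPartialHomeomorph S ℂ → ℂ → ℝ
  pos : ∀ e ∈ conformalCoordinates S, ∀ z ∈ e.target ∩ e.symm ⁻¹' Pᶜ, 0 < density e z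
  smooth : ∀ e ∈ conformalCoordinates S, ContDiffOn ℝ ∞ (density e) (e.target ∩ e.symm ⁻¹' Pᶜ)
  compat : ∀ e ∈ conformalCoordinates S, ∀ e' ∈ conformalCoordinates S,
    ∀ x ∈ e.source ∩ e'.source, x ∉ P →
      density e (e x) = density e' (e' x) * ‖deriv (e' ∘ e.symm) (e x)‖ ^ 2

variable {S} {P : Set S}

/-- The matrix `gᵢⱼ` of the metric in the real coordinates `(x, y)`, `x + i y = e(·)`. -/
def ConformalMetric.matrix (g : ConformalMetric S P) (e : OpenPartialHomeomorph S ℂ) (z : ℂ) :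
    Matrix (Fin 2) (Fin 2) ℝ :=
  Matrix.diagonal fun _ => g.density e z

/-- `g` has a conical singularity of order `b` at `p`: in a conformal coordinate `z` with
`z(p) = 0` it is `ρ(z) |z|^(2b) |dz|²` near `p`, with `ρ` continuous and positive. -/
def ConformalMetric.HasConicalSingularity (g : ConformalMetric S P) (p : S) (b : ℝ) : Prop :=
  ∃ e ∈ conformalCoordinates S, p ∈ e.source ∧ e p = 0 ∧
    ∃ ρ : ℂ → ℝ, ∃ U ∈ 𝓝 (0 : ℂ), U ⊆ e.target ∧ ContinuousOn ρ U ∧ (∀ z ∈ U, 0 < ρ z) ∧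
      ∀ z ∈ U, z ≠ 0 → g.density e z = ρ z * ‖z‖ ^ (2 * b)

/-- `F_k(s, θ)`: the function `u(r, θ)` in terms of `θ` and `s = 2ᵏ r^(b+1) / (b+1)`. -/
def rescaled (b : ℝ) (u : ℂ → ℝ) (k : ℕ) (x : ℝ × ℝ) : ℝ :=
  u ((((b + 1) * (x.1 / 2 ^ k)) ^ (1 / (b + 1)) : ℝ) * Complex.exp (x.2 * Complex.I))

/-- `u` is weighted `C^{l,α}` near the cone point `0` of order `b`: the functions `F_k(s, θ)` are
bounded in the Hölder space `C^{l,α}` of `1/2 < s < 2`, `θ ∈ S¹`, uniformly in `k` (large enough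
for `u` to be given on the corresponding annuli). -/
def IsWeightedHolder (b : ℝ) (l : ℕ) (α : ℝ≥0) (u : ℂ → ℝ) : Prop :=
  ∃ C : ℝ≥0, ∀ᶠ k : ℕ in atTop,
    ContDiffOn ℝ l (rescaled b u k) (Ioo (1 / 2) 2 ×ˢ univ) ∧
    (∀ j ≤ l, ∀ x ∈ Ioo (1 / 2 : ℝ) 2 ×ˢ (univ : Set ℝ),
      ‖iteratedFDeriv ℝ j (rescaled b u k) x‖ ≤ C) ∧
    HolderOnWith C α (iteratedFDeriv ℝ l (rescaled b u k)) (Ioo (1 / 2) 2 ×ˢ univ)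

/-- `g` is a `C^{l,α}` cone metric of order `b` at `p`: in a conformal coordinate `z` with
`z(p) = 0` it is `e^{2u} |z|^(2b) |dz|²` near `p`, with `u` weighted `C^{l,α}`. -/
def ConformalMetric.IsHolderConeAt (g : ConformalMetric S P) (p : S) (b : ℝ) (l : ℕ) (α : ℝ≥0) :
    Prop :=
  ∃ e ∈ conformalCoordinates S, p ∈ e.source ∧ e p = 0 ∧
    ∃ u : ℂ → ℝ, IsWeightedHolder b l α u ∧
      ∀ᶠ z in 𝓝[≠] (0 : ℂ), g.density e z = Real.exp (2 * u z) * ‖z‖ ^ (2 * b)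

/-- `g` is a cone metric in the conformal class `(S, β)`, `β = ∑ βᵢ pᵢ`: away from the points `pᵢ`
it is a smooth conformal metric, and it has a conical singularity of order `βᵢ` at `pᵢ`, which is
moreover of weighted class `C^{l,α}` for all `l` and `α`. -/
def ConformalMetric.InConformalClass (g : ConformalMetric S P) (β : S →₀ ℝ) : Prop :=
  P = β.support ∧ ∀ p ∈ β.support, g.HasConicalSingularity p (β p) ∧
    ∀ (l : ℕ) (α : ℝ≥0), 0 < α → α < 1 → g.IsHolderConeAt p (β p) l α

/-- `½ R gᵢⱼ - κ gᵢⱼ = ∇ᵢⱼ f` on `S \ P`, for a function `f` that is continuous on `S` and smooth on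
`S \ P`. -/
def ConformalMetric.IsGradientSoliton (g : ConformalMetric S P) (κ : ℝ) : Prop :=
  ∃ f : S → ℝ, Continuous f ∧ ∀ e ∈ conformalCoordinates S,
    ContDiffOn ℝ ∞ (f ∘ e.symm) (e.target ∩ e.symm ⁻¹' Pᶜ) ∧
    ∀ z ∈ e.target ∩ e.symm ⁻¹' Pᶜ, ∀ i j : Fin 2,
      (1 / 2) * LocalGeometry.scalarCurvature (g.matrix e) z * g.matrix e z i j
        - κ * g.matrix e z i j
        = LocalGeometry.hessian (g.matrix e) (f ∘ e.symm) i j z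

/-- `g` is invariant under the rotations about `p` and `q` (on the Riemann sphere): in a conformal
coordinate `z` on the complement of `q` with values in all of `ℂ` and `z(p) = 0`, the density of
`g` depends on `|z|` only. -/
def ConformalMetric.IsRotationallySymmetric (g : ConformalMetric S P) (p q : S) : Prop :=
  ∃ e ∈ conformalCoordinates S, e.source = {q}ᶜ ∧ e.target = univ ∧ e p = 0 ∧
    ∀ z w : ℂ, z ≠ 0 → ‖z‖ = ‖w‖ → g.density e z = g.density e w

end Surface

end

noncomputable section

/-! ### The profile of a rotationally symmetric soliton -/

namespace SolitonProfile

/-! The metric comes from the momentum construction. In a coordinate z with p₁ = 0 and p₂ = ∞, put t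
= log |z| and look for g = Φ(X(t)) |dz/z|², where X' = Φ(X). Here X is a moment map of the
rotations. The Hessian of X is ½ Φ'(X) g and the scalar curvature is -Φ''(X). With f = c X the
soliton equation therefore becomes Φ'' = -2 - c Φ', which follows from the linear equation Φ' = -2x
- c Φ (`soliton_equation`).

Let a = λ₁ + 1 and b = λ₂ + 1. The moment map should run through (-a, b), with Φ positive there and
zero at both ends. The linear equation then forces the slopes 2a at -a and -2b at b, exactly those
that give the prescribed cone orders. The solution vanishing at -a is Φ(x) = -2 exp(-c x) ∫ y exp(c
y) dy over [-a, x], so the only remaining condition is that the integral over [-a, b] vanish. That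
integral changes sign as c varies, and the intermediate value theorem supplies c
(`exists_integral_mul_exp_eq_zero`).

For regularity at p₁, factor Φ = W V near -a so that W(X(t)) is a constant multiple of w = exp(2at)
= |z|^(2a) (`exists_factorization`). Inverting W shows that X and Φ(X)/w are smooth functions of w
up to and beyond w = 0 (`exists_isEnd`). Hence g = |z|^(2λ₁) H(|z|^(2(λ₁+1))) |dz|² with H smooth
and positive, which gives both the cone singularity and the weighted Hölder bounds. The other pole
is the same statement for Φ(-x) and -X(-t), since z ↦ 1/z reverses t. If λᵢ = 0, the metric and
potential are smooth at pᵢ and the soliton equation extends there by continuity. -/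

lemma analyticAt_dslope {f : ℝ → ℝ} (hf : ∀ x, AnalyticAt ℝ f x) (a x : ℝ) :
    AnalyticAt ℝ (dslope f a) x := by
  by_cases hx : x = a
  · subst hx
    obtain ⟨p, hp⟩ := hf x
    exact ⟨_, hp.has_fpower_series_dslope_fslope⟩
  · have h : AnalyticAt ℝ (fun y => (y - a)⁻¹ • (f y - f a)) x :=
      ((analyticAt_id.sub analyticAt_const).inv (sub_ne_zero.2 hx)).smul
        ((hf x).sub analyticAt_const)
    refine h.congr ?_
    filter_upwards [isOpen_ne.mem_nhds hx] with y hy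
    rw [dslope_of_ne _ hy, slope_def_module]

/-- A function that vanishes to first order at the left end `-a` is a product `W V`, where `V` is
positive and `log |W|` is a primitive of `2 a / Φ`. -/
lemma exists_factorization {Φ : ℝ → ℝ} {a b : ℝ} (hab : -a < b)
    (ha : 0 < a) (hΦ : ∀ x, AnalyticAt ℝ Φ x) (h0 : Φ (-a) = 0) (hd : HasDerivAt Φ (2 * a) (-a))
    (hpos : ∀ x ∈ Ioo (-a) b, 0 < Φ x) (hneg : ∀ x < -a, Φ x < 0) :
    ∃ W V : ℝ → ℝ, ContDiffOn ℝ ∞ V (Iio b) ∧ (∀ x < b, 0 < V x) ∧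
      (∀ x < b, HasDerivAt W (2 * a / V x) x) ∧ (∀ x < b, Φ x = W x * V x) ∧ W (-a) = 0 := by
  -- Analyticity of Φ makes both this difference quotient and the next one analytic through -a.
  set ψ := dslope Φ (-a) with hψ
  have hψa : ψ (-a) = 2 * a := by rw [hψ, dslope_same, hd.deriv]
  have hΦψ : ∀ x, Φ x = (x + a) * ψ x := by
    intro x
    have := sub_smul_dslope Φ (-a) x
    simp only [smul_eq_mul, h0, sub_zero, sub_neg_eq_add] at this
    exact this.symm
  have hψan : ∀ x, AnalyticAt ℝ ψ x := analyticAt_dslope hΦ _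
  have hψpos : ∀ x < b, 0 < ψ x := by
    intro x hx
    rcases lt_trichotomy x (-a) with h | h | h
    · have := hneg x h
      rw [hΦψ] at this
      exact pos_of_mul_neg_right this (by linarith)
    · rw [h, hψa]; positivity
    · have := hpos x ⟨h, hx⟩
      rw [hΦψ] at this
      exact (pos_iff_pos_of_mul_pos this).1 (by linarith)
  -- As Φ = (x + a) ψ and ψ(-a) = 2a, one has 2a/Φ = 1/(x + a) + n with n regular at -a. So log |x +
  -- a| + ∫ n is the wanted primitive.
  set n : ℝ → ℝ := fun x => -dslope ψ (-a) x / ψ x with hn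
  have hψn : ∀ x < b, (x + a) * n x = 2 * a / ψ x - 1 := by
    intro x hx
    have h1 := sub_smul_dslope ψ (-a) x
    simp only [smul_eq_mul, hψa, sub_neg_eq_add] at h1
    have h2 := (hψpos x hx).ne'
    simp only [hn]
    field_simp
    linarith
  have hnsm : ContDiffOn ℝ ∞ n (Iio b) := by
    intro x hx
    exact (((analyticAt_dslope hψan _ x).neg.div (hψan x)
      (hψpos x hx).ne').contDiffAt).contDiffWithinAt
  set N : ℝ → ℝ := fun x => ∫ y in (-a)..x, n y with hN
  have hNd : ∀ x < b, HasDerivAt N (n x) x := by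
    intro x hx
    have hsub : uIcc (-a) x ⊆ Iio b := by
      intro y hy
      rcases le_total (-a) x with h | h
      · rw [uIcc_of_le h] at hy; exact lt_of_le_of_lt hy.2 hx
      · rw [uIcc_of_ge h] at hy; exact lt_of_le_of_lt hy.2 hab
    refine intervalIntegral.integral_hasDerivAt_right
      (hnsm.continuousOn.mono hsub).intervalIntegrable ?_
      (hnsm.continuousOn.continuousAt (Iio_mem_nhds hx))
    exact hnsm.continuousOn.stronglyMeasurableAtFilter isOpen_Iio x hx
  have hNsm : ContDiffOn ℝ ∞ N (Iio b) := by
    rw [contDiffOn_infty_iff_deriv_of_isOpen isOpen_Iio]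
    exact ⟨fun x hx => (hNd x hx).differentiableAt.differentiableWithinAt,
      hnsm.congr fun x hx => (hNd x hx).deriv⟩
  refine ⟨fun x => (x + a) * Real.exp (N x), fun x => ψ x * Real.exp (-N x), ?_, ?_, ?_, ?_, ?_⟩
  · exact ContDiffOn.mul (fun x _ => (hψan x).contDiffAt.contDiffWithinAt)
      (Real.contDiff_exp.comp_contDiffOn hNsm.neg)
  · intro x hx
    have := hψpos x hx
    positivity
  · intro x hx
    have h := ((hasDerivAt_id x).add_const a).mul (hNd x hx).exp
    refine h.congr_deriv ?_
    have h1 := hψn x hx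
    have h2 := (hψpos x hx).ne'
    have h3 : 2 * a / ψ x = (x + a) * n x + 1 := by linarith
    simp only [id, Real.exp_neg]
    rw [← div_div, h3, div_inv_eq_mul]
    ring
  · intro x _
    simp only [hΦψ, Real.exp_neg]
    field_simp
  · simp

lemma strictMonoOn_of_factor {W V : ℝ → ℝ} {a b : ℝ} (ha : 0 < a)
    (hV : ∀ x < b, 0 < V x) (hW : ∀ x < b, HasDerivAt W (2 * a / V x) x) :
    StrictMonoOn W (Iio b) := by
  refine strictMonoOn_of_deriv_pos (convex_Iio b)
    (fun x hx => (hW x hx).continuousAt.continuousWithinAt) fun x hx => ?_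
  rw [interior_Iio] at hx
  rw [(hW x hx).deriv]
  have := hV x hx
  positivity

/-- The derivative 2a/V is positive, so W is injective and the inverse function theorem applies at
every point. The domain reaches to the left of -a, so the inverse is smooth in a full neighbourhood
of W(-a). -/
lemma exists_smooth_inverse {W V : ℝ → ℝ} {a b : ℝ} (ha : 0 < a)
    (hVs : ContDiffOn ℝ ∞ V (Iio b)) (hV : ∀ x < b, 0 < V x)
    (hW : ∀ x < b, HasDerivAt W (2 * a / V x) x) :
    ∃ Y : ℝ → ℝ, IsOpen (W '' Iio b) ∧ ContDiffOn ℝ ∞ Y (W '' Iio b) ∧ ∀ x < b, Y (W x) = x := by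
  have hWs : ContDiffOn ℝ ∞ W (Iio b) := by
    rw [contDiffOn_infty_iff_deriv_of_isOpen isOpen_Iio]
    exact ⟨fun x hx => (hW x hx).differentiableAt.differentiableWithinAt,
      (contDiffOn_const.div hVs fun x hx => (hV x hx).ne').congr fun x hx => (hW x hx).deriv⟩
  have hinj := (strictMonoOn_of_factor ha hV hW).injOn
  have hpos : ∀ x < b, 2 * a / V x ≠ 0 := fun x hx => by
    have := hV x hx
    positivity
  have hstrict : ∀ x < b, HasStrictDerivAt W (2 * a / V x) x := fun x hx =>
    (hWs.contDiffAt (Iio_mem_nhds hx)).hasStrictDerivAt' (hW x hx) (by simp)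
  have hopen : IsOpenMap ((Iio b).domRestrict W) := by
    rw [isOpenMap_iff_nhds_le]
    rintro ⟨x, hx⟩
    have h := (hstrict x hx).map_nhds_eq (hpos x hx)
    have h1 : map ((Iio b).domRestrict W) (𝓝 ⟨x, hx⟩) = map W (𝓝 x) := by
      rw [domRestrict_eq, ← Filter.map_map, map_nhds_subtype_coe_eq_nhds hx (Iio_mem_nhds hx)]
    rw [h1, h]
    rfl
  let e := OpenPartialHomeomorph.ofContinuousOpenRestrict (hinj.toPartialEquiv W (Iio b))
    hWs.continuousOn hopen isOpen_Iio
  refine ⟨e.symm, e.open_target, ?_, fun x hx => e.left_inv hx⟩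
  rintro w ⟨x, hx, rfl⟩
  have hx' : e.symm (W x) = x := e.left_inv hx
  refine (e.contDiffAt_symm_deriv (f₀' := 2 * a / V x) (hpos x hx) (e.map_source hx) ?_
    ?_).contDiffWithinAt
  · change HasDerivAt W _ (e.symm (W x))
    rw [hx']; exact hW x hx
  · change ContDiffAt ℝ ∞ W (e.symm (W x))
    rw [hx']; exact hWs.contDiffAt (Iio_mem_nhds hx)

/-- Smooth extension across the end `t = -∞` of a solution of `X' = Φ(X)`, in terms of the
coordinate `exp (2 a t)`. -/
structure IsEnd (a : ℝ) (Φ X Y H : ℝ → ℝ) (O : Set ℝ) : Prop where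
  isOpen : IsOpen O
  Ici_subset : Ici 0 ⊆ O
  contDiffOn_Y : ContDiffOn ℝ ∞ Y O
  contDiffOn_H : ContDiffOn ℝ ∞ H O
  pos : ∀ w ∈ O, 0 < H w
  X_eq : ∀ t, X t = Y (Real.exp (2 * a * t))
  Φ_eq : ∀ t, Φ (X t) = Real.exp (2 * a * t) * H (Real.exp (2 * a * t))

/-- From W' = 2a/V and Φ = W V, the function y = W(X(t)) satisfies y' = 2a y. Hence it equals K
exp(2at) with K > 0, and X is recovered by the smooth inverse of W. -/
lemma exists_isEnd {Φ X W V : ℝ → ℝ} {a b : ℝ} (ha : 0 < a) (hab : -a < b)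
    (hVs : ContDiffOn ℝ ∞ V (Iio b)) (hV : ∀ x < b, 0 < V x)
    (hW : ∀ x < b, HasDerivAt W (2 * a / V x) x) (hΦ : ∀ x < b, Φ x = W x * V x)
    (hWa : W (-a) = 0) (hXm : ∀ t, X t ∈ Ioo (-a) b) (hX : ∀ t, HasDerivAt X (Φ (X t)) t) :
    ∃ Y H O, IsEnd a Φ X Y H O := by
  obtain ⟨Y, hO, hY, hYW⟩ := exists_smooth_inverse ha hVs hV hW
  have hconst : ∀ t, W (X t) * Real.exp (-(2 * a * t)) = W (X 0) * Real.exp (-(2 * a * 0)) := by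
    have hder : ∀ t, HasDerivAt (fun t => W (X t) * Real.exp (-(2 * a * t))) 0 t := by
      intro t
      have h1 := (hW (X t) (hXm t).2).comp t (hX t)
      have h2 := (((hasDerivAt_id t).const_mul (2 * a)).neg).exp
      refine (h1.mul h2).congr_deriv ?_
      have := (hV (X t) (hXm t).2).ne'
      simp only [hΦ _ (hXm t).2, id, Function.comp, Pi.neg_apply]
      field_simp
      ring
    intro t
    exact is_const_of_deriv_eq_zero (fun t => (hder t).differentiableAt)
      (fun t => (hder t).deriv) t 0
  set K := W (X 0) with hK
  have hKpos : 0 < K := by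
    rw [← hWa, hK]
    exact strictMonoOn_of_factor ha hV hW hab (hXm 0).2 (hXm 0).1
  have hWX : ∀ t, W (X t) = K * Real.exp (2 * a * t) := by
    intro t
    have := hconst t
    rw [Real.exp_neg] at this
    have h2 := Real.exp_pos (2 * a * t)
    field_simp at this
    simpa [mul_comm] using this
  have hXY : ∀ t, X t = Y (K * Real.exp (2 * a * t)) := fun t => by
    rw [← hWX, hYW _ (hXm t).2]
  have hmaps : MapsTo Y (W '' Iio b) (Iio b) := by
    rintro _ ⟨x, hx, rfl⟩
    rw [hYW x hx]
    exact hx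
  have hmul : ContDiffOn ℝ ∞ (fun w => K * w) ((fun w => K * w) ⁻¹' (W '' Iio b)) := by fun_prop
  refine ⟨fun w => Y (K * w), fun w => K * V (Y (K * w)), (fun w => K * w) ⁻¹' (W '' Iio b),
    hO.preimage (by fun_prop), ?_, hY.comp hmul fun w hw => hw,
    contDiffOn_const.mul (hVs.comp (hY.comp hmul fun w hw => hw) fun w hw => hmaps hw),
    fun w hw => mul_pos hKpos (hV _ (hmaps hw)), hXY, ?_⟩
  -- The value w = 0 corresponds to the end -a itself, and w > 0 is attained at time log w / (2a).
  · intro w hw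
    rcases (mem_Ici.1 hw).eq_or_lt with h | h
    · exact ⟨-a, hab, by simp [← h, hWa]⟩
    · refine ⟨X (Real.log w / (2 * a)), (hXm _).2, ?_⟩
      rw [hWX, mul_div_cancel₀ _ (by positivity), Real.exp_log h]
  · intro t
    rw [← hXY, hΦ _ (hXm t).2, hWX]
    ring

/-- Separation of variables: X inverts a primitive T of 1/Φ on (-a, b). The solution exists for all
time because Φ vanishes to first order at both ends, so T tends to -∞ and +∞. Here W' and V' are the
factors of Φ(-x) at its end -b, not derivatives. -/
lemma exists_solution {Φ W V W' V' : ℝ → ℝ} {a b : ℝ} (ha : 0 < a) (hb : 0 < b)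
    (hVs : ContDiffOn ℝ ∞ V (Iio b)) (hV : ∀ x < b, 0 < V x)
    (hW : ∀ x < b, HasDerivAt W (2 * a / V x) x) (hΦ : ∀ x < b, Φ x = W x * V x)
    (hWa : W (-a) = 0) (hV' : ∀ x < a, 0 < V' x)
    (hW' : ∀ x < a, HasDerivAt W' (2 * b / V' x) x) (hΦ' : ∀ x < a, Φ (-x) = W' x * V' x)
    (hWb : W' (-b) = 0) :
    ∃ X : ℝ → ℝ, (∀ t, X t ∈ Ioo (-a) b) ∧ ∀ t, HasDerivAt X (Φ (X t)) t := by
  have hab : -a < b := by linarith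
  have hmono := strictMonoOn_of_factor ha hV hW
  have hmono' := strictMonoOn_of_factor hb hV' hW'
  have hWpos : ∀ x ∈ Ioo (-a) b, 0 < W x := fun x hx => by
    rw [← hWa]; exact hmono hab hx.2 hx.1
  have hWpos' : ∀ x ∈ Ioo (-a) b, 0 < W' (-x) := fun x hx => by
    rw [← hWb]
    exact hmono' (show -b < a by linarith) (show -x < a by linarith [hx.1]) (by linarith [hx.2])
  set T : ℝ → ℝ := fun x => Real.log (W x) / (2 * a) with hT
  have hTd : ∀ x ∈ Ioo (-a) b, HasDerivAt T (Φ x)⁻¹ x := by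
    intro x hx
    refine (((hW x hx.2).log (hWpos x hx).ne').div_const (2 * a)).congr_deriv ?_
    rw [hΦ x hx.2]
    have := (hV x hx.2).ne'
    have := (hWpos x hx).ne'
    field_simp
  have hTd' : ∀ x ∈ Ioo (-a) b,
      HasDerivAt (fun x => -(Real.log (W' (-x)) / (2 * b))) (Φ x)⁻¹ x := by
    intro x hx
    have hx' : -x < a := by linarith [hx.1]
    have h1 := (hW' (-x) hx').comp x (hasDerivAt_neg x)
    refine ((h1.log (hWpos' x hx).ne').div_const (2 * b)).neg.congr_deriv ?_
    have := hΦ' (-x) hx'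
    rw [neg_neg] at this
    rw [this]
    have := (hV' (-x) hx').ne'
    have := (hWpos' x hx).ne'
    simp only [Function.comp]
    field_simp
  -- The two factorizations give two primitives of 1/Φ. The first shows the behaviour at -a, the
  -- second at b.
  obtain ⟨C, hC⟩ : ∃ C, ∀ x ∈ Ioo (-a) b, T x = -(Real.log (W' (-x)) / (2 * b)) + C := by
    have h := isOpen_Ioo.exists_eq_add_of_deriv_eq (s := Ioo (-a) b) isPreconnected_Ioo
      (f := T) (g := fun x => -(Real.log (W' (-x)) / (2 * b)))
      (fun x hx => (hTd x hx).differentiableAt.differentiableWithinAt)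
      (fun x hx => (hTd' x hx).differentiableAt.differentiableWithinAt)
      (fun x hx => by rw [(hTd x hx).deriv, (hTd' x hx).deriv])
    obtain ⟨C, hC⟩ := h
    exact ⟨C, hC⟩
  have hsurj : SurjOn T (Ioo (-a) b) univ := by
    refine ContinuousOn.surjOn_of_tendsto (nonempty_Ioo.2 hab)
      (fun x hx => (hTd x hx).continuousAt.continuousWithinAt) ?_ ?_
    · rw [tendsto_comp_coe_Ioo_atBot hab (f := T)]
      have h1 : Tendsto W (𝓝[>] (-a)) (𝓝[>] 0) := by
        refine tendsto_nhdsWithin_iff.2 ⟨?_, ?_⟩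
        · have := (hW (-a) hab).continuousAt.tendsto
          rw [hWa] at this
          exact this.mono_left nhdsWithin_le_nhds
        · filter_upwards [Ioo_mem_nhdsGT hab] with x hx using hWpos x hx
      exact (Real.tendsto_log_nhdsGT_zero.comp h1).atBot_div_const (by positivity)
    · rw [tendsto_comp_coe_Ioo_atTop hab (f := T)]
      have h1 : Tendsto (fun x => W' (-x)) (𝓝[<] b) (𝓝[>] 0) := by
        refine tendsto_nhdsWithin_iff.2 ⟨?_, ?_⟩
        · have := (hW' (-b) (by linarith)).continuousAt.tendsto.comp (continuous_neg.tendsto b)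
          rw [hWb] at this
          exact this.mono_left nhdsWithin_le_nhds
        · filter_upwards [Ioo_mem_nhdsLT hab] with x hx using hWpos' x hx
      have h2 := (Real.tendsto_log_nhdsGT_zero.comp h1).atBot_div_const
        (show 0 < 2 * b by positivity)
      have h3 := tendsto_atTop_add_const_right _ C (tendsto_neg_atBot_atTop.comp h2)
      refine h3.congr' ?_
      filter_upwards [Ioo_mem_nhdsLT hab] with x hx
      rw [hC x hx]
      rfl
  obtain ⟨Y, hO, hY, hYW⟩ := exists_smooth_inverse ha hVs hV hW
  have key : ∀ t, ∃ x ∈ Ioo (-a) b, W x = Real.exp (2 * a * t) := by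
    intro t
    obtain ⟨x, hx, hxt⟩ := hsurj (mem_univ t)
    refine ⟨x, hx, ?_⟩
    rw [← hxt, hT]
    simp only
    rw [mul_div_cancel₀ _ (by positivity), Real.exp_log (hWpos x hx)]
  choose X hXm hXW using key
  have hXY : X = fun t => Y (Real.exp (2 * a * t)) := by
    funext t
    rw [← hXW, hYW _ (hXm t).2]
  refine ⟨X, hXm, fun t => ?_⟩
  have hdiff : DifferentiableAt ℝ X t := by
    rw [hXY]
    have hmem : Real.exp (2 * a * t) ∈ W '' Iio b := ⟨X t, (hXm t).2, hXW t⟩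
    exact ((hY.contDiffAt (hO.mem_nhds hmem)).differentiableAt (by simp)).comp t
      (by fun_prop : DifferentiableAt ℝ (fun t => Real.exp (2 * a * t)) t)
  -- Differentiating W(X(t)) = exp(2at) in two ways determines X'.
  have h1 := (hW (X t) (hXm t).2).comp t hdiff.hasDerivAt
  have h2 : HasDerivAt (W ∘ X) (Real.exp (2 * a * t) * (2 * a)) t := by
    have : W ∘ X = fun t => Real.exp (2 * a * t) := funext hXW
    rw [this]
    simpa using ((hasDerivAt_id t).const_mul (2 * a)).exp
  have h3 := h1.unique h2
  refine hdiff.hasDerivAt.congr_deriv ?_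
  rw [hΦ _ (hXm t).2, hXW]
  have := (hV (X t) (hXm t).2).ne'
  field_simp at h3
  linarith

/-- On [-a, 0] use exp(c y) ≤ 1, which bounds the integral below by -a²/2. On [0, b] use exp(c y) ≥
c y, which gives at least c b³/3. The threshold on c is where these balance. -/
lemma integral_mul_exp_nonneg {a b c : ℝ} (ha : 0 < a) (hb : 0 < b)
    (hc : 3 * a ^ 2 / (2 * b ^ 3) ≤ c) : 0 ≤ ∫ y in (-a)..b, y * Real.exp (c * y) := by
  have hint : ∀ p q : ℝ, IntervalIntegrable (fun y : ℝ => y * Real.exp (c * y))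
      MeasureTheory.volume p q := fun p q => (by fun_prop : Continuous _).intervalIntegrable p q
  have hc0 : 0 ≤ c := le_trans (by positivity) hc
  rw [← intervalIntegral.integral_add_adjacent_intervals (hint (-a) 0) (hint 0 b)]
  have h1 : ∫ y in (-a)..0, y ≤ ∫ y in (-a)..0, y * Real.exp (c * y) := by
    refine intervalIntegral.integral_mono_on (by linarith)
      (continuous_id.intervalIntegrable _ _) (hint _ _) fun y hy => ?_
    have : Real.exp (c * y) ≤ 1 := Real.exp_le_one_iff.2 (mul_nonpos_of_nonneg_of_nonpos hc0 hy.2)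
    nlinarith [hy.2]
  have h2 : ∫ y in (0 : ℝ)..b, c * y ^ 2 ≤ ∫ y in (0 : ℝ)..b, y * Real.exp (c * y) := by
    refine intervalIntegral.integral_mono_on hb.le
      ((by fun_prop : Continuous fun y : ℝ => c * y ^ 2).intervalIntegrable _ _) (hint _ _)
      fun y hy => ?_
    have := Real.add_one_le_exp (c * y)
    nlinarith [hy.1]
  rw [integral_id] at h1
  rw [intervalIntegral.integral_const_mul, integral_pow] at h2
  rw [div_le_iff₀ (by positivity)] at hc
  norm_num at h1 h2
  nlinarith

lemma exists_integral_mul_exp_eq_zero {a b : ℝ} (ha : 0 < a) (hb : 0 < b) :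
    ∃ c : ℝ, ∫ y in (-a)..b, y * Real.exp (c * y) = 0 := by
  have hcont : Continuous fun c : ℝ => ∫ y in (-a)..b, y * Real.exp (c * y) :=
    intervalIntegral.continuous_parametric_intervalIntegral_of_continuous'
      (by fun_prop : Continuous fun p : ℝ × ℝ => p.2 * Real.exp (p.1 * p.2)) _ _
  refine mem_range_of_exists_le_of_exists_ge hcont ⟨-(3 * b ^ 2 / (2 * a ^ 3)), ?_⟩
    ⟨_, integral_mul_exp_nonneg ha hb le_rfl⟩
  -- The reflection y ↦ -y exchanges a with b, changes the sign of c and negates the integral, so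
  -- the opposite inequality comes from the same bound.
  have h := integral_mul_exp_nonneg hb ha (c := 3 * b ^ 2 / (2 * a ^ 3)) le_rfl
  have h2 := intervalIntegral.integral_comp_neg (a := -b) (b := a)
    (fun y : ℝ => y * Real.exp (-(3 * b ^ 2 / (2 * a ^ 3)) * y))
  rw [neg_neg] at h2
  rw [← h2]
  simp only [neg_mul, mul_neg, neg_neg, intervalIntegral.integral_neg]
  linarith

/-- A primitive of `y ↦ y exp (c y)`. -/
lemma exists_analytic_primitive (c : ℝ) : ∃ Q : ℝ → ℝ, (∀ x, AnalyticAt ℝ Q x) ∧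
    ∀ x, HasDerivAt Q (x * Real.exp (c * x)) x := by
  by_cases hc : c = 0
  · refine ⟨fun x => x ^ 2 / 2, fun x => by fun_prop, fun x => ?_⟩
    have := (hasDerivAt_pow 2 x).div_const 2
    refine this.congr_deriv ?_
    simp [hc]
  · refine ⟨fun x => (c * x - 1) / c ^ 2 * Real.exp (c * x), fun x => ?_, fun x => ?_⟩
    · simp only [div_eq_mul_inv]
      fun_prop
    · have h1 := (hasDerivAt_id x).const_mul c
      refine (((h1.sub_const 1).div_const (c ^ 2)).mul h1.exp).congr_deriv ?_
      simp only [id]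
      field_simp
      ring

/-- The square of the length of the rotation field, as a function of the moment map. -/
lemma exists_momentProfile {a b : ℝ} (ha : 0 < a) (hb : 0 < b) :
    ∃ (c : ℝ) (Φ : ℝ → ℝ), (∀ x, AnalyticAt ℝ Φ x) ∧
      (∀ x, HasDerivAt Φ (-2 * x - c * Φ x) x) ∧ Φ (-a) = 0 ∧ Φ b = 0 ∧
      (∀ x ∈ Ioo (-a) b, 0 < Φ x) ∧ (∀ x < -a, Φ x < 0) ∧ ∀ x > b, Φ x < 0 := by
  obtain ⟨c, hc⟩ := exists_integral_mul_exp_eq_zero ha hb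
  obtain ⟨Q, hQ, hQd⟩ := exists_analytic_primitive c
  have hQab : Q b = Q (-a) := by
    rw [intervalIntegral.integral_eq_sub_of_hasDerivAt (f := Q) (fun x _ => hQd x)
      ((by fun_prop : Continuous fun y : ℝ => y * Real.exp (c * y)).intervalIntegrable _ _)] at hc
    linarith
  have hcont : Continuous Q := continuous_iff_continuousAt.2 fun x => (hQ x).continuousAt
  -- Q decreases up to 0 and increases afterwards, and takes equal values at -a and b. It is thus
  -- below that value between them and above it outside, which gives the sign of Φ.
  have hanti : StrictAntiOn Q (Iic 0) := by
    refine strictAntiOn_of_deriv_neg (convex_Iic 0) hcont.continuousOn fun x hx => ?_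
    rw [interior_Iic] at hx
    rw [(hQd x).deriv]
    exact mul_neg_of_neg_of_pos hx (Real.exp_pos _)
  have hmono : StrictMonoOn Q (Ici 0) := by
    refine strictMonoOn_of_deriv_pos (convex_Ici 0) hcont.continuousOn fun x hx => ?_
    rw [interior_Ici] at hx
    rw [(hQd x).deriv]
    exact mul_pos hx (Real.exp_pos _)
  -- Variation of constants: the equation says (exp(c x) Φ)' = -2 x exp(c x).
  refine ⟨c, fun x => 2 * (Q (-a) - Q x) * Real.exp (-(c * x)), fun x => ?_, fun x => ?_, by simp,
    by simp [hQab], fun x hx => ?_, fun x hx => ?_, fun x hx => ?_⟩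
  · have := hQ x
    fun_prop
  · have h1 := (((hQd x).const_sub (Q (-a))).const_mul 2).mul
      ((hasDerivAt_id x).const_mul c).neg.exp
    refine h1.congr_deriv ?_
    have : Real.exp (c * x) * Real.exp (-(c * x)) = 1 := by rw [← Real.exp_add]; simp
    simp only [id, Pi.neg_apply]
    linear_combination (-2 * x) * this
  · have : Q x < Q (-a) := by
      rcases le_total x 0 with h | h
      · exact hanti (by simpa using ha.le) h hx.1
      · rw [← hQab]
        exact hmono h hb.le hx.2
    exact mul_pos (by linarith) (Real.exp_pos _)
  · have : Q (-a) < Q x := hanti (by simp only [mem_Iic]; linarith) (by simpa using ha.le) hx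
    exact mul_neg_of_neg_of_pos (by linarith) (Real.exp_pos _)
  · have : Q (-a) < Q x := by
      rw [← hQab]
      exact hmono hb.le (by simp only [mem_Ici]; linarith) hx
    exact mul_neg_of_neg_of_pos (by linarith) (Real.exp_pos _)

/-- Time reversal turns the end at b into an end of the first kind: -X(-t) solves the equation for
Φ(-x), with a and b exchanged. The slopes required by `exists_factorization` are read off from the
linear equation at the zeros of Φ. -/
theorem exists_profile {a b : ℝ} (ha : 0 < a) (hb : 0 < b) :
    ∃ (c : ℝ) (Φ X Y₁ H₁ : ℝ → ℝ) (O₁ : Set ℝ) (Y₂ H₂ : ℝ → ℝ) (O₂ : Set ℝ),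
      (∀ x, HasDerivAt Φ (-2 * x - c * Φ x) x) ∧ (∀ t, HasDerivAt X (Φ (X t)) t) ∧
      IsEnd a Φ X Y₁ H₁ O₁ ∧ IsEnd b (fun x => Φ (-x)) (fun t => -X (-t)) Y₂ H₂ O₂ := by
  obtain ⟨c, Φ, han, hd, hΦa, hΦb, hpos, hneg, hneg'⟩ := exists_momentProfile ha hb
  have hab : -a < b := by linarith
  have hba : -b < a := by linarith
  obtain ⟨W, V, hVs, hV, hW, hΦ, hWa⟩ := exists_factorization hab ha han hΦa
    ((hd (-a)).congr_deriv (by rw [hΦa]; ring)) hpos hneg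
  obtain ⟨W', V', hVs', hV', hW', hΦ', hWb⟩ := exists_factorization (Φ := fun x => Φ (-x)) hba hb
    (fun x => (han (-x)).fun_comp analyticAt_id.neg) (by simpa using hΦb)
    (by
      have h := (hd (- -b)).comp (-b) (hasDerivAt_neg (-b))
      refine h.congr_deriv ?_
      rw [neg_neg, hΦb]
      ring)
    (fun x hx => hpos (-x) ⟨by linarith [hx.2], by linarith [hx.1]⟩)
    (fun x hx => hneg' (-x) (by linarith))
  obtain ⟨X, hXm, hX⟩ := exists_solution ha hb hVs hV hW hΦ hWa hV' hW' hΦ' hWb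
  obtain ⟨Y₁, H₁, O₁, h₁⟩ := exists_isEnd ha hab hVs hV hW hΦ hWa hXm hX
  obtain ⟨Y₂, H₂, O₂, h₂⟩ := exists_isEnd (X := fun t => -X (-t)) hb hba hVs' hV' hW' hΦ' hWb
    (fun t => ⟨by linarith [(hXm (-t)).2], by linarith [(hXm (-t)).1]⟩)
    (fun t => (((hX (-t)).comp t (hasDerivAt_neg t)).neg).congr_deriv (by simp))
  exact ⟨c, Φ, X, Y₁, H₁, O₁, Y₂, H₂, O₂, hd, hX, h₁, h₂⟩

end SolitonProfile

/-! ### Curvature and Hessian of ρ |dz|², and the soliton equation -/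

namespace LocalGeometry

lemma pd_congr {F G : ℂ → ℝ} {z : ℂ} (h : F =ᶠ[𝓝 z] G) (i : Fin 2) : pd i F z = pd i G z := by
  rw [pd, pd, h.fderiv_eq]

lemma pd_eq_of_hasFDerivAt {F : ℂ → ℝ} {F' : ℂ →L[ℝ] ℝ} {z : ℂ} (h : HasFDerivAt F F' z)
    (i : Fin 2) : pd i F z = F' (![1, Complex.I] i) := by
  rw [pd, h.fderiv]

@[simp] lemma pd_const (c : ℝ) (i : Fin 2) (z : ℂ) : pd i (fun _ => c) z = 0 := by
  simp [pd]

lemma pd_const_mul (c : ℝ) {F : ℂ → ℝ} {z : ℂ} (hF : DifferentiableAt ℝ F z) (i : Fin 2) :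
    pd i (fun w => c * F w) z = c * pd i F z := by
  rw [pd_eq_of_hasFDerivAt (hF.hasFDerivAt.const_mul c)]
  rfl

lemma pd_neg (F : ℂ → ℝ) (z : ℂ) (i : Fin 2) : pd i (fun w => -F w) z = -pd i F z := by
  have h : fderiv ℝ (fun w => -F w) z = -fderiv ℝ F z := fderiv_fun_neg
  rw [pd, h]
  rfl

lemma pd_add {F G : ℂ → ℝ} {z : ℂ} (hF : DifferentiableAt ℝ F z) (hG : DifferentiableAt ℝ G z)
    (i : Fin 2) : pd i (fun w => F w + G w) z = pd i F z + pd i G z := by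
  exact pd_eq_of_hasFDerivAt (F := fun w => F w + G w) (hF.hasFDerivAt.add hG.hasFDerivAt) i

lemma pd_mul {F G : ℂ → ℝ} {z : ℂ} (hF : DifferentiableAt ℝ F z) (hG : DifferentiableAt ℝ G z)
    (i : Fin 2) : pd i (fun w => F w * G w) z = F z * pd i G z + G z * pd i F z := by
  exact pd_eq_of_hasFDerivAt (F := fun w => F w * G w) (hF.hasFDerivAt.mul hG.hasFDerivAt) i

lemma pd_comp {φ : ℝ → ℝ} {φ' : ℝ} {F : ℂ → ℝ} {z : ℂ} (hφ : HasDerivAt φ φ' (F z))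
    (hF : DifferentiableAt ℝ F z) (i : Fin 2) : pd i (fun w => φ (F w)) z = φ' * pd i F z := by
  exact pd_eq_of_hasFDerivAt (F := fun w => φ (F w)) (hφ.comp_hasFDerivAt z hF.hasFDerivAt) i

lemma diagonal_inv_apply {r : ℝ} (hr : r ≠ 0) (k l : Fin 2) :
    (Matrix.diagonal fun _ : Fin 2 => r)⁻¹ k l = if k = l then r⁻¹ else 0 := by
  have h : (Matrix.diagonal fun _ : Fin 2 => r)⁻¹ = Matrix.diagonal fun _ => r⁻¹ := by
    apply Matrix.inv_eq_left_inv
    rw [Matrix.diagonal_mul_diagonal, ← Matrix.diagonal_one]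
    congr 1
    funext _
    exact inv_mul_cancel₀ hr
  rw [h, Matrix.diagonal_apply]

lemma pd_diagonal (ρ : ℂ → ℝ) (i k l : Fin 2) (z : ℂ) :
    pd i (fun w => (Matrix.diagonal fun _ : Fin 2 => ρ w) k l) z
      = if k = l then pd i ρ z else 0 := by
  by_cases h : k = l
  · subst h; simp
  · simp [h]

/-- Here μ is the gradient of log ρ. In terms of it the symbols are linear and free of denominators,
so they are easy to differentiate again. -/
lemma christoffel_diagonal {ρ : ℂ → ℝ} {μ : Fin 2 → ℂ → ℝ} {z : ℂ} (hρ : ρ z ≠ 0)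
    (hμ : ∀ i, pd i ρ z = ρ z * μ i z) (k i j : Fin 2) :
    christoffel (fun w => Matrix.diagonal fun _ => ρ w) k i j z
      = (1 / 2) * ((if k = j then μ i z else 0) + (if k = i then μ j z else 0)
        + -(if i = j then μ k z else 0)) := by
  simp only [christoffel, diagonal_inv_apply hρ, pd_diagonal, hμ, Fin.sum_univ_two]
  fin_cases k <;> fin_cases i <;> fin_cases j <;> simp <;> field_simp

/-- The scalar curvature of `ρ |dz|²` is `- (Δ log ρ) / ρ`. -/
lemma scalarCurvature_diagonal {ρ : ℂ → ℝ} {μ : Fin 2 → ℂ → ℝ} {z : ℂ}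
    (hρ : ∀ᶠ w in 𝓝 z, ρ w ≠ 0) (hμ : ∀ᶠ w in 𝓝 z, ∀ i, pd i ρ w = ρ w * μ i w)
    (hd : ∀ i, DifferentiableAt ℝ (μ i) z) :
    scalarCurvature (fun w => Matrix.diagonal fun _ => ρ w) z
      = -(pd 0 (μ 0) z + pd 1 (μ 1) z) / ρ z := by
  have hΓ : ∀ k i j, christoffel (fun w => Matrix.diagonal fun _ => ρ w) k i j =ᶠ[𝓝 z]
      fun w => (1 / 2) * ((if k = j then μ i w else 0) + (if k = i then μ j w else 0)
        + -(if i = j then μ k w else 0)) := fun k i j => by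
    filter_upwards [hρ, hμ] with w h1 h2 using christoffel_diagonal h1 h2 k i j
  have hpd : ∀ m k i j, pd m (christoffel (fun w => Matrix.diagonal fun _ => ρ w) k i j) z
      = (1 / 2) * ((if k = j then pd m (μ i) z else 0) + (if k = i then pd m (μ j) z else 0)
        + -(if i = j then pd m (μ k) z else 0)) := fun m k i j => by
    have hif : ∀ (p : Prop) [Decidable p] (n : Fin 2),
        DifferentiableAt ℝ (fun w => if p then μ n w else 0) z := fun p _ n => by
      split_ifs
      · exact hd n
      · exact differentiableAt_const _
    have hpif : ∀ (p : Prop) [Decidable p] (n : Fin 2),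
        pd m (fun w => if p then μ n w else 0) z = if p then pd m (μ n) z else 0 := fun p _ n => by
      split_ifs <;> simp
    rw [pd_congr (hΓ k i j),
      pd_const_mul _ (((hif _ i).fun_add (hif _ j)).fun_add (hif _ k).fun_neg),
      pd_add ((hif _ i).fun_add (hif _ j)) (hif _ k).fun_neg, pd_add (hif _ i) (hif _ j), pd_neg,
      hpif, hpif, hpif]
  have hz := hρ.self_of_nhds
  have hmz := hμ.self_of_nhds
  simp only [scalarCurvature, ricci, diagonal_inv_apply hz, hpd,
    christoffel_diagonal hz hmz, Fin.sum_univ_two]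
  simp
  field_simp
  ring

lemma hessian_diagonal {ρ : ℂ → ℝ} {μ : Fin 2 → ℂ → ℝ} {z : ℂ} (hρ : ρ z ≠ 0)
    (hμ : ∀ i, pd i ρ z = ρ z * μ i z) (F : ℂ → ℝ) (i j : Fin 2) :
    hessian (fun w => Matrix.diagonal fun _ => ρ w) F i j z
      = pd i (pd j F) z - ∑ k, (1 / 2) * ((if k = j then μ i z else 0) +
        (if k = i then μ j z else 0) + -(if i = j then μ k z else 0)) * pd k F z := by
  simp only [hessian, christoffel_diagonal hρ hμ]

/-! #### Holomorphic functions -/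

lemma pd_re {B : ℂ → ℂ} {B' z : ℂ} (h : HasDerivAt B B' z) (i : Fin 2) :
    pd i (fun w => (B w).re) z = (![B'.re, -B'.im] i) := by
  rw [pd_eq_of_hasFDerivAt (F := fun w => (B w).re)
    (Complex.reCLM.hasFDerivAt.comp z (h.hasFDerivAt.restrictScalars ℝ))]
  fin_cases i <;> simp

lemma pd_im {B : ℂ → ℂ} {B' z : ℂ} (h : HasDerivAt B B' z) (i : Fin 2) :
    pd i (fun w => (B w).im) z = (![B'.im, B'.re] i) := by
  rw [pd_eq_of_hasFDerivAt (F := fun w => (B w).im)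
    (Complex.imCLM.hasFDerivAt.comp z (h.hasFDerivAt.restrictScalars ℝ))]
  fin_cases i <;> simp

lemma differentiableAt_re {B : ℂ → ℂ} {z : ℂ} (h : DifferentiableAt ℂ B z) :
    DifferentiableAt ℝ (fun w => (B w).re) z :=
  Complex.reCLM.differentiableAt.comp z (h.restrictScalars ℝ)

lemma differentiableAt_im {B : ℂ → ℂ} {z : ℂ} (h : DifferentiableAt ℂ B z) :
    DifferentiableAt ℝ (fun w => (B w).im) z :=
  Complex.imCLM.differentiableAt.comp z (h.restrictScalars ℝ)

lemma differentiableAt_normSq {B : ℂ → ℂ} {z : ℂ} (h : DifferentiableAt ℂ B z) :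
    DifferentiableAt ℝ (fun w => Complex.normSq (B w)) z := by
  simp only [Complex.normSq_apply]
  exact ((differentiableAt_re h).mul (differentiableAt_re h)).add
    ((differentiableAt_im h).mul (differentiableAt_im h))

lemma pd_normSq {B : ℂ → ℂ} {B' z : ℂ} (h : HasDerivAt B B' z) (hB : B z ≠ 0) (i : Fin 2) :
    pd i (fun w => Complex.normSq (B w)) z
      = Complex.normSq (B z) * (2 * ![(B' / B z).re, -(B' / B z).im] i) := by
  have h1 := differentiableAt_re h.differentiableAt
  have h2 := differentiableAt_im h.differentiableAt
  have h3 : Complex.normSq (B z) ≠ 0 := by simpa using hB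
  have h4 := Complex.normSq_apply (B z)
  simp only [Complex.normSq_apply (B _)]
  rw [pd_add (h1.fun_mul h1) (h2.fun_mul h2), pd_mul h1 h1, pd_mul h2 h2, pd_re h, pd_im h]
  fin_cases i <;> simp [Complex.div_re, Complex.div_im] <;> field_simp <;> rw [h4] <;> ring

lemma log_norm_eq (w : ℂ) : Real.log ‖w‖ = (1 / 2) * Real.log (Complex.normSq w) := by
  rw [Complex.normSq_eq_norm_sq, Real.log_pow]
  push_cast
  ring

lemma differentiableAt_log_norm {B : ℂ → ℂ} {z : ℂ} (h : DifferentiableAt ℂ B z) (hB : B z ≠ 0) :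
    DifferentiableAt ℝ (fun w => Real.log ‖B w‖) z := by
  simp only [log_norm_eq]
  exact ((differentiableAt_normSq h).log (by simpa using hB)).const_mul _

lemma pd_log_norm {B : ℂ → ℂ} {B' z : ℂ} (h : HasDerivAt B B' z) (hB : B z ≠ 0) (i : Fin 2) :
    pd i (fun w => Real.log ‖B w‖) z = ![(B' / B z).re, -(B' / B z).im] i := by
  have h3 : Complex.normSq (B z) ≠ 0 := by simpa using hB
  simp only [log_norm_eq]
  rw [pd_comp (φ := fun x => 1 / 2 * Real.log x) (F := fun w => Complex.normSq (B w)) ((Real.hasDerivAt_log h3).const_mul _)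
    (differentiableAt_normSq h.differentiableAt), pd_normSq h hB]
  field_simp

/-- The soliton equation for `Φ(X(log |T|)) |dT / T|²` with the potential `c X(log |T|)`. -/
lemma soliton_equation {c : ℝ} {Φ X : ℝ → ℝ} (hΦ : ∀ x, HasDerivAt Φ (-2 * x - c * Φ x) x)
    (hX : ∀ t, HasDerivAt X (Φ (X t)) t) (hpos : ∀ t, 0 < Φ (X t)) {T : ℂ → ℂ} {z : ℂ}
    (hT : AnalyticAt ℂ T z) (hT0 : T z ≠ 0) (hT1 : deriv T z ≠ 0) {ρ F : ℂ → ℝ}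
    (hρ : ∀ᶠ w in 𝓝 z, ρ w = Φ (X (Real.log ‖T w‖)) * Complex.normSq (deriv T w / T w))
    (hF : ∀ᶠ w in 𝓝 z, F w = c * X (Real.log ‖T w‖)) (i j : Fin 2) :
    (1 / 2) * scalarCurvature (fun w => Matrix.diagonal fun _ => ρ w) z
        * (Matrix.diagonal fun _ => ρ z : Matrix (Fin 2) (Fin 2) ℝ) i j
        - 1 * (Matrix.diagonal fun _ => ρ z : Matrix (Fin 2) (Fin 2) ℝ) i j
      = hessian (fun w => Matrix.diagonal fun _ => ρ w) F i j z := by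
  -- A and B are the complex derivatives of log T and log A. Below, α and δ are the real gradients
  -- of log |T| and log |A|, and k is Φ'(X). As ρ = Φ(X) |A|², the gradient of log ρ is μ = k α + 2
  -- δ.
  set A : ℂ → ℂ := fun w => deriv T w / T w with hAdef
  set B : ℂ → ℂ := fun w => deriv A w / A w with hBdef
  have hA : AnalyticAt ℂ A z := hT.deriv.div hT hT0
  have hA0 : A z ≠ 0 := div_ne_zero hT1 hT0
  have hB : AnalyticAt ℂ B z := hA.deriv.div hA hA0
  set ξ : ℂ → ℝ := fun w => X (Real.log ‖T w‖) with hξdef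
  set α : Fin 2 → ℂ → ℝ := ![fun w => (A w).re, fun w => -(A w).im] with hα
  set δ : Fin 2 → ℂ → ℝ := ![fun w => (B w).re, fun w => -(B w).im] with hδ
  set k : ℂ → ℝ := fun w => -2 * ξ w - c * Φ (ξ w) with hk
  have hξ : ∀ᶠ w in 𝓝 z, DifferentiableAt ℝ ξ w ∧ ∀ i, pd i ξ w = Φ (ξ w) * α i w := by
    filter_upwards [hT.eventually_analyticAt, hT.continuousAt.eventually_ne hT0] with w h1 h2
    have h3 := differentiableAt_log_norm h1.differentiableAt h2
    refine ⟨(hX _).differentiableAt.comp w h3, fun i => ?_⟩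
    have := pd_comp (F := fun w => Real.log ‖T w‖) (hX _) h3 i
    rw [pd_log_norm h1.differentiableAt.hasDerivAt h2] at this
    rw [this]
    fin_cases i <;> rfl
  have hΦξ : ∀ {w}, DifferentiableAt ℝ ξ w → DifferentiableAt ℝ (fun w => Φ (ξ w)) w :=
    fun h => (hΦ _).differentiableAt.comp _ h
  have hkd : ∀ {w}, DifferentiableAt ℝ ξ w → DifferentiableAt ℝ k w :=
    fun h => (h.const_mul _).fun_sub ((hΦξ h).const_mul _)
  have hAB : ∀ᶠ w in 𝓝 z, A w ≠ 0 ∧ AnalyticAt ℂ A w :=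
    (hA.continuousAt.eventually_ne hA0).and hA.eventually_analyticAt
  have hαd : ∀ {w}, AnalyticAt ℂ A w → ∀ i, DifferentiableAt ℝ (α i) w := by
    intro w hw i
    fin_cases i
    · exact differentiableAt_re hw.differentiableAt
    · exact (differentiableAt_im hw.differentiableAt).neg
  have hδd : ∀ i, DifferentiableAt ℝ (δ i) z := by
    intro i
    fin_cases i
    · exact differentiableAt_re hB.differentiableAt
    · exact (differentiableAt_im hB.differentiableAt).neg
  set μ : Fin 2 → ℂ → ℝ := fun i w => k w * α i w + 2 * δ i w with hμdef
  have hξz := hξ.self_of_nhds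
  have hkz := hkd hξz.1
  have hμ : ∀ᶠ w in 𝓝 z, ∀ i, pd i ρ w = ρ w * μ i w := by
    filter_upwards [hξ, hAB, hρ.eventually_nhds] with w h1 h2 h3 i
    rw [pd_congr h3, h3.self_of_nhds]
    rw [pd_mul (hΦξ h1.1) (differentiableAt_normSq h2.2.differentiableAt),
      pd_comp (hΦ (ξ w)) h1.1, h1.2, pd_normSq h2.2.differentiableAt.hasDerivAt h2.1]
    have : ![(deriv A w / A w).re, -(deriv A w / A w).im] i = δ i w := by fin_cases i <;> rfl
    rw [this]
    simp only [hμdef, hk]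
    ring
  have hμd : ∀ i, DifferentiableAt ℝ (μ i) z := fun i =>
    (hkz.fun_mul (hαd hA i)).fun_add ((hδd i).const_mul 2)
  have hρpos : ∀ᶠ w in 𝓝 z, ρ w ≠ 0 := by
    filter_upwards [hρ, hAB] with w h1 h2
    rw [h1]
    exact mul_ne_zero (hpos _).ne' (mt Complex.normSq_eq_zero.1 h2.1)
  have hkpd : ∀ i, pd i k z = (-2 - c * k z) * Φ (ξ z) * α i z := by
    intro i
    have h1 : HasDerivAt (fun x => -2 * x - c * Φ x) (-2 * 1 - c * (-2 * ξ z - c * Φ (ξ z))) (ξ z) :=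
      ((hasDerivAt_id _).const_mul (-2)).fun_sub ((hΦ _).const_mul c)
    have h2 := pd_comp h1 hξz.1 i
    rw [hξz.2] at h2
    rw [show k = fun w => -2 * ξ w - c * Φ (ξ w) from rfl, h2]
    ring
  have hα00 : ∀ i, pd i (α 0) z = ![(deriv A z).re, -(deriv A z).im] i :=
    pd_re hA.differentiableAt.hasDerivAt
  have hα1 : ∀ i, pd i (α 1) z = -![(deriv A z).im, (deriv A z).re] i := fun i => by
    rw [show α 1 = fun w => -(A w).im from rfl, pd_neg, pd_im hA.differentiableAt.hasDerivAt]
  -- The second derivatives of log |A| cancel in the curvature: log |A| is harmonic.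
  have hδ0 : pd 0 (δ 0) z = (deriv B z).re := pd_re hB.differentiableAt.hasDerivAt 0
  have hδ1 : pd 1 (δ 1) z = -(deriv B z).re := by
    rw [show δ 1 = fun w => -(B w).im from rfl, pd_neg, pd_im hB.differentiableAt.hasDerivAt]
    rfl
  have hμpd : ∀ i, pd i (μ i) z = k z * pd i (α i) z + α i z * pd i k z + 2 * pd i (δ i) z := by
    intro i
    simp only [hμdef]
    rw [pd_add (hkz.fun_mul (hαd hA i)) ((hδd i).const_mul 2), pd_mul hkz (hαd hA i),
      pd_const_mul 2 (hδd i)]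
  have hFpd : ∀ j, pd j F =ᶠ[𝓝 z] fun w => c * (Φ (ξ w) * α j w) := by
    intro j
    filter_upwards [hF.eventually_nhds, hξ] with w h1 h2
    rw [pd_congr h1, pd_const_mul c h2.1, h2.2]
  have hFpd2 : ∀ i j, pd i (pd j F) z
      = c * (Φ (ξ z) * pd i (α j) z + α j z * (k z * (Φ (ξ z) * α i z))) := by
    intro i j
    rw [pd_congr (hFpd j), pd_const_mul c ((hΦξ hξz.1).fun_mul (hαd hA j)),
      pd_mul (hΦξ hξz.1) (hαd hA j), pd_comp (hΦ (ξ z)) hξz.1, hξz.2]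
  have hz := hρpos.self_of_nhds
  have hρz := hρ.self_of_nhds
  have hL : ∀ R : ℝ, (1 / 2) * (R / ρ z)
      * (Matrix.diagonal fun _ => ρ z : Matrix (Fin 2) (Fin 2) ℝ) i j
      - 1 * (Matrix.diagonal fun _ => ρ z : Matrix (Fin 2) (Fin 2) ℝ) i j
      = if i = j then (1 / 2) * R - ρ z else 0 := fun R => by
    rw [Matrix.diagonal_apply]
    split_ifs
    · field_simp
    · simp
  rw [scalarCurvature_diagonal hρpos hμ hμd, hL, hessian_diagonal hz hμ.self_of_nhds,
    Fin.sum_univ_two, hμpd, hμpd, hFpd2, (hFpd 0).self_of_nhds, (hFpd 1).self_of_nhds,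
    hδ0, hδ1, hkpd, hkpd]
  -- With A' = B A, the four components become polynomial identities in Φ, k, c and the real and
  -- imaginary parts of A and B.
  have hdA : deriv A z = B z * A z := (div_mul_cancel₀ _ hA0).symm
  have e0 : α 0 z = (A z).re := rfl
  have e1 : α 1 z = -(A z).im := rfl
  have d0 : δ 0 z = (B z).re := rfl
  have d1 : δ 1 z = -(B z).im := rfl
  have hns : Complex.normSq (deriv T z / T z) = (A z).re * (A z).re + (A z).im * (A z).im :=
    Complex.normSq_apply _
  have hρz' : ρ z = Φ (ξ z) * ((A z).re * (A z).re + (A z).im * (A z).im) := by rw [hρz, hns]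
  fin_cases i <;> fin_cases j <;>
    simp [hα00, hα1, hdA, hμdef, e0, e1, d0, d1, hρz'] <;> ring

/-! #### Continuity of the curvature and of the Hessian -/

lemma contDiffOn_pd {F : ℂ → ℝ} {s : Set ℂ} (hs : IsOpen s) (hF : ContDiffOn ℝ ∞ F s) (i : Fin 2) :
    ContDiffOn ℝ ∞ (pd i F) s :=
  (hF.fderiv_of_isOpen hs (by simp)).clm_apply contDiffOn_const

lemma contDiffOn_diagonal_inv {ρ : ℂ → ℝ} {s : Set ℂ} (hρ : ContDiffOn ℝ ∞ ρ s)
    (h0 : ∀ z ∈ s, ρ z ≠ 0) (k l : Fin 2) :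
    ContDiffOn ℝ ∞ (fun w => (Matrix.diagonal fun _ : Fin 2 => ρ w)⁻¹ k l) s := by
  by_cases h : k = l
  · exact (hρ.inv h0).congr fun w hw => by simp [diagonal_inv_apply (h0 w hw), h]
  · exact (contDiffOn_const (c := (0 : ℝ))).congr fun w hw => by
      simp [diagonal_inv_apply (h0 w hw), h]

lemma contDiffOn_christoffel {ρ : ℂ → ℝ} {s : Set ℂ} (hs : IsOpen s) (hρ : ContDiffOn ℝ ∞ ρ s)
    (h0 : ∀ z ∈ s, ρ z ≠ 0) (k i j : Fin 2) :
    ContDiffOn ℝ ∞ (christoffel (fun w => Matrix.diagonal fun _ => ρ w) k i j) s := by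
  have hpd : ∀ i k l, ContDiffOn ℝ ∞
      (pd i fun w => (Matrix.diagonal fun _ : Fin 2 => ρ w) k l) s := by
    refine fun i k l => contDiffOn_pd hs ?_ i
    by_cases h : k = l
    · exact hρ.congr fun w _ => by simp [h]
    · exact (contDiffOn_const (c := (0 : ℝ))).congr fun w _ => by simp [h]
  exact contDiffOn_const.mul (ContDiffOn.sum fun l _ => (contDiffOn_diagonal_inv hρ h0 k l).mul
    (((hpd _ _ _).add (hpd _ _ _)).sub (hpd _ _ _)))

lemma continuousOn_scalarCurvature {ρ : ℂ → ℝ} {s : Set ℂ} (hs : IsOpen s)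
    (hρ : ContDiffOn ℝ ∞ ρ s) (h0 : ∀ z ∈ s, ρ z ≠ 0) :
    ContinuousOn (scalarCurvature fun w => Matrix.diagonal fun _ => ρ w) s := by
  have hΓ := contDiffOn_christoffel hs hρ h0
  have h : ContDiffOn ℝ ∞ (scalarCurvature fun w => Matrix.diagonal fun _ => ρ w) s :=
    ContDiffOn.sum fun j _ => ContDiffOn.sum fun k _ =>
      (contDiffOn_diagonal_inv hρ h0 j k).mul (ContDiffOn.sum fun i _ =>
        ((contDiffOn_pd hs (hΓ _ _ _) _).sub (contDiffOn_pd hs (hΓ _ _ _) _)).add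
        (ContDiffOn.sum fun p _ => ((hΓ _ _ _).mul (hΓ _ _ _)).sub ((hΓ _ _ _).mul (hΓ _ _ _))))
  exact h.continuousOn

lemma continuousOn_hessian {ρ F : ℂ → ℝ} {s : Set ℂ} (hs : IsOpen s)
    (hρ : ContDiffOn ℝ ∞ ρ s) (h0 : ∀ z ∈ s, ρ z ≠ 0) (hF : ContDiffOn ℝ ∞ F s) (i j : Fin 2) :
    ContinuousOn (hessian (fun w => Matrix.diagonal fun _ => ρ w) F i j) s := by
  have hΓ := contDiffOn_christoffel hs hρ h0
  have h : ContDiffOn ℝ ∞ (hessian (fun w => Matrix.diagonal fun _ => ρ w) F i j) s :=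
    (contDiffOn_pd hs (contDiffOn_pd hs hF j) i).sub
      (ContDiffOn.sum fun k _ => (hΓ _ _ _).mul (contDiffOn_pd hs hF k))
  exact h.continuousOn

/-- The soliton equation extends across a point at which the metric and the potential are smooth. -/
lemma soliton_equation_of_punctured {ρ F : ℂ → ℝ} {s : Set ℂ} {z : ℂ} (hs : IsOpen s) (hz : z ∈ s)
    (hρ : ContDiffOn ℝ ∞ ρ s) (h0 : ∀ z ∈ s, ρ z ≠ 0) (hF : ContDiffOn ℝ ∞ F s) (i j : Fin 2)
    (h : ∀ᶠ w in 𝓝[≠] z, (1 / 2) * scalarCurvature (fun w => Matrix.diagonal fun _ => ρ w) w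
        * (Matrix.diagonal fun _ => ρ w : Matrix (Fin 2) (Fin 2) ℝ) i j
        - 1 * (Matrix.diagonal fun _ => ρ w : Matrix (Fin 2) (Fin 2) ℝ) i j
      = hessian (fun w => Matrix.diagonal fun _ => ρ w) F i j w) :
    (1 / 2) * scalarCurvature (fun w => Matrix.diagonal fun _ => ρ w) z
        * (Matrix.diagonal fun _ => ρ z : Matrix (Fin 2) (Fin 2) ℝ) i j
        - 1 * (Matrix.diagonal fun _ => ρ z : Matrix (Fin 2) (Fin 2) ℝ) i j
      = hessian (fun w => Matrix.diagonal fun _ => ρ w) F i j z := by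
  have hG : ContinuousOn (fun w => (Matrix.diagonal fun _ : Fin 2 => ρ w) i j) s := by
    by_cases h : i = j
    · exact hρ.continuousOn.congr fun w _ => by simp [h]
    · exact (continuousOn_const (c := (0 : ℝ))).congr fun w _ => by simp [h]
  have h1 := (((continuousOn_const (c := (1 / 2 : ℝ))).mul
    (continuousOn_scalarCurvature hs hρ h0)).mul hG).sub ((continuousOn_const (c := (1 : ℝ))).mul hG)
  have h2 := continuousOn_hessian hs hρ h0 hF i j
  have hn := hs.mem_nhds hz
  exact tendsto_nhds_unique_of_eventuallyEq
    ((h1.continuousAt hn).tendsto.mono_left nhdsWithin_le_nhds)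
    ((h2.continuousAt hn).tendsto.mono_left nhdsWithin_le_nhds) h

end LocalGeometry

/-! ### Biholomorphic maps and adapted coordinates of the sphere -/

namespace RiemannSphere

lemma coordZero_mem : coordZero ∈ conformalCoordinates RiemannSphere :=
  StructureGroupoid.subset_maximalAtlas _ (Or.inl rfl)

lemma coordInfty_mem : coordInfty ∈ conformalCoordinates RiemannSphere :=
  StructureGroupoid.subset_maximalAtlas _ (Or.inr rfl)

lemma coordZero_target : coordZero.target = univ := by
  simp [coordZero]

lemma coordInfty_target : coordInfty.target = univ := by
  simp [coordInfty, coordZero_target]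

/-- A self-map of the sphere that is given by analytic expressions in the two standard coordinates
is holomorphic. -/
lemma contMDiffAt_of_eventuallyEq {F : RiemannSphere → RiemannSphere} {x : RiemannSphere}
    {e e' : OpenPartialHomeomorph RiemannSphere ℂ} (he : e ∈ conformalCoordinates RiemannSphere)
    (he' : e' ∈ conformalCoordinates RiemannSphere) (hx : x ∈ e.source) {t : ℂ → ℂ}
    (ht : ContDiffAt ℂ ω t (e x)) (htx : t (e x) ∈ e'.target)
    (h : F =ᶠ[𝓝 x] fun y => e'.symm (t (e y))) : ContMDiffAt 𝓘(ℂ) 𝓘(ℂ) ω F x := by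
  refine ContMDiffAt.congr_of_eventuallyEq ?_ h
  exact (contMDiffAt_symm_of_mem_maximalAtlas he' htx).comp x
    (ht.contMDiffAt.comp x (contMDiffAt_of_mem_maximalAtlas he hx))

lemma inversion_inversion (x : RiemannSphere) : inversion (inversion x) = x :=
  inversionFun_inversionFun x

lemma inversion_infty : inversion OnePoint.infty = ((0 : ℂ) : OnePoint ℂ) := rfl

lemma inversion_zero : inversion ((0 : ℂ) : OnePoint ℂ) = OnePoint.infty := by
  rw [← inversion_infty, inversion_inversion]

lemma contMDiff_inversion : ContMDiff 𝓘(ℂ) 𝓘(ℂ) ω inversion := by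
  intro x
  induction x using OnePoint.rec with
  | infty =>
    refine contMDiffAt_of_eventuallyEq (t := id) coordInfty_mem coordZero_mem
      (by simp [coordInfty_source]) contDiffAt_id (by simp [coordZero_target]) ?_
    have : {((0 : ℂ) : OnePoint ℂ)}ᶜ ∈ 𝓝 (OnePoint.infty : OnePoint ℂ) :=
      isOpen_compl_singleton.mem_nhds (by simp)
    filter_upwards [this] with y hy
    rw [id, coordInfty_apply]
    refine (coordZero.left_inv ?_).symm
    rw [coordZero_source]
    intro h
    apply hy
    rw [mem_singleton_iff] at h ⊢
    rw [← inversion_inversion y, ← inversion_infty, ← h]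
  | coe z =>
    refine contMDiffAt_of_eventuallyEq (t := id) coordZero_mem coordInfty_mem
      (by simp [coordZero_source]) contDiffAt_id (by simp [coordInfty_target]) ?_
    have : {(OnePoint.infty : OnePoint ℂ)}ᶜ ∈ 𝓝 (z : OnePoint ℂ) :=
      isOpen_compl_singleton.mem_nhds (by simp)
    filter_upwards [this] with y hy
    rw [id, coordInfty_symm, ← coordZero_symm, coordZero.left_inv]
    · rfl
    · rwa [coordZero_source]

/-- The inversion `z ↦ 1 / z` as a biholomorphic map. -/
def inversionDiffeo : RiemannSphere ≃ₘ^ω⟮𝓘(ℂ), 𝓘(ℂ)⟯ RiemannSphere where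
  toEquiv := inversion.toEquiv
  contMDiff_toFun := contMDiff_inversion
  contMDiff_invFun := contMDiff_inversion

/-- The translation `z ↦ z + c` of the Riemann sphere. -/
def translation (c : ℂ) : RiemannSphere ≃ₜ RiemannSphere :=
  (Homeomorph.addRight c).onePointCongr

lemma translation_coe (c z : ℂ) : translation c (z : OnePoint ℂ) = ((z + c : ℂ) : OnePoint ℂ) := rfl

lemma translation_infty (c : ℂ) : translation c OnePoint.infty = OnePoint.infty := rfl

lemma translation_symm (c : ℂ) : ⇑(translation c).symm = translation (-c) := by
  funext x
  rw [Homeomorph.symm_apply_eq]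
  induction x using OnePoint.rec with
  | infty => rfl
  | coe z => simp [translation_coe]

lemma contMDiff_translation (c : ℂ) : ContMDiff 𝓘(ℂ) 𝓘(ℂ) ω (translation c) := by
  intro x
  induction x using OnePoint.rec with
  | infty =>
    have h0 : coordInfty OnePoint.infty = 0 := by
      rw [coordInfty_apply, inversionFun_infty, coordZero_coe]
    -- Translation by c written in the coordinate w = 1/z.
    refine contMDiffAt_of_eventuallyEq (t := fun w => w / (1 + c * w)) coordInfty_mem coordInfty_mem
      (by simp [coordInfty_source]) ?_ (by simp [coordInfty_target]) ?_
    · rw [h0]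
      exact contDiffAt_id.div (by fun_prop) (by simp)
    · have h1 : {((0 : ℂ) : OnePoint ℂ)}ᶜ ∈ 𝓝 (OnePoint.infty : OnePoint ℂ) :=
        isOpen_compl_singleton.mem_nhds (by simp)
      have h2 : {((-c : ℂ) : OnePoint ℂ)}ᶜ ∈ 𝓝 (OnePoint.infty : OnePoint ℂ) :=
        isOpen_compl_singleton.mem_nhds (by simp)
      filter_upwards [h1, h2] with y hy hy'
      induction y using OnePoint.rec with
      | infty => simp [h0, translation_infty, coordInfty_symm, inversionFun_coe]
      | coe z =>
        have hz : z ≠ 0 := fun h => hy (by rw [h]; rfl)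
        have hzc : z + c ≠ 0 := fun h => hy' (by rw [eq_neg_of_add_eq_zero_left h]; rfl)
        have hw : z⁻¹ / (1 + c * z⁻¹) = (z + c)⁻¹ := by field_simp
        rw [coordInfty_apply, inversionFun_coe, if_neg hz, coordZero_coe, hw, coordInfty_symm,
          inversionFun_coe, if_neg (inv_ne_zero hzc), inv_inv, translation_coe]
  | coe z =>
    refine contMDiffAt_of_eventuallyEq (t := fun w => w + c) coordZero_mem coordZero_mem
      (by simp [coordZero_source]) (by fun_prop) (by simp [coordZero_target]) ?_
    have : {(OnePoint.infty : OnePoint ℂ)}ᶜ ∈ 𝓝 (z : OnePoint ℂ) :=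
      isOpen_compl_singleton.mem_nhds (by simp)
    filter_upwards [this] with y hy
    induction y using OnePoint.rec with
    | infty => exact absurd rfl hy
    | coe w => rw [coordZero_coe, coordZero_symm, translation_coe]

/-- The translation `z ↦ z + c` as a biholomorphic map. -/
def translationDiffeo (c : ℂ) : RiemannSphere ≃ₘ^ω⟮𝓘(ℂ), 𝓘(ℂ)⟯ RiemannSphere where
  toEquiv := (translation c).toEquiv
  contMDiff_toFun := contMDiff_translation c
  contMDiff_invFun := by
    change ContMDiff 𝓘(ℂ) 𝓘(ℂ) ω (translation c).symm
    rw [translation_symm]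
    exact contMDiff_translation _

/-- The biholomorphic maps of the sphere act transitively on pairs of distinct points. -/
lemma exists_diffeo {p₁ p₂ : RiemannSphere} (hp : p₁ ≠ p₂) :
    ∃ Ψ : RiemannSphere ≃ₘ^ω⟮𝓘(ℂ), 𝓘(ℂ)⟯ RiemannSphere,
      Ψ p₁ = ((0 : ℂ) : OnePoint ℂ) ∧ Ψ p₂ = OnePoint.infty := by
  have key : ∀ {p : RiemannSphere}, p ≠ OnePoint.infty →
      ∃ Ψ : RiemannSphere ≃ₘ^ω⟮𝓘(ℂ), 𝓘(ℂ)⟯ RiemannSphere,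
        Ψ p = ((0 : ℂ) : OnePoint ℂ) ∧ Ψ OnePoint.infty = OnePoint.infty := by
    intro p h
    induction p using OnePoint.rec with
    | infty => exact absurd rfl h
    | coe z =>
      refine ⟨translationDiffeo (-z), ?_, rfl⟩
      change translation (-z) z = _
      rw [translation_coe, add_neg_cancel]
  by_cases h : p₂ = OnePoint.infty
  · subst h
    exact key hp
  -- Translate p₂ to 0 and invert, which puts it at ∞; then translate the image of p₁ to 0.
  · obtain ⟨Ψ, h1, -⟩ := key h
    have h2 : (Ψ.trans inversionDiffeo) p₂ = OnePoint.infty := by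
      change inversion (Ψ p₂) = _
      rw [h1, inversion_zero]
    have h3 : (Ψ.trans inversionDiffeo) p₁ ≠ OnePoint.infty := by
      rw [← h2]
      exact fun h => hp ((Ψ.trans inversionDiffeo).injective h)
    obtain ⟨Ψ', h4, h5⟩ := key h3
    exact ⟨(Ψ.trans inversionDiffeo).trans Ψ', h4, (congrArg Ψ' h2).trans h5⟩

/-- This moves the standard coordinates to an arbitrary pair of points, so no metric has to be
pulled back. -/
lemma diffeo_trans_mem (Ψ : RiemannSphere ≃ₘ^ω⟮𝓘(ℂ), 𝓘(ℂ)⟯ RiemannSphere)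
    {e : OpenPartialHomeomorph RiemannSphere ℂ} (he : e ∈ conformalCoordinates RiemannSphere) :
    Ψ.toHomeomorph.toOpenPartialHomeomorph ≫ₕ e ∈ conformalCoordinates RiemannSphere := by
  refine OpenPartialHomeomorph.mem_maximalAtlas_of_contMDiffOn (I := 𝓘(ℂ)) (n := ω) _ ?_ ?_
  · exact (contMDiffOn_of_mem_maximalAtlas he).comp Ψ.contMDiff.contMDiffOn fun x hx => hx.2
  · exact Ψ.symm.contMDiff.comp_contMDiffOn
      ((contMDiffOn_symm_of_mem_maximalAtlas he).mono fun z hz => hz.1)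

/-- Two distinct points of the sphere are `0` and `∞` in a suitable coordinate. -/
theorem exists_coordinates {p₁ p₂ : RiemannSphere} (hp : p₁ ≠ p₂) :
    ∃ e₁ ∈ conformalCoordinates RiemannSphere, ∃ e₂ ∈ conformalCoordinates RiemannSphere,
      e₁.source = {p₂}ᶜ ∧ e₁.target = univ ∧ e₁ p₁ = 0 ∧
      e₂.source = {p₁}ᶜ ∧ e₂.target = univ ∧ e₂ p₂ = 0 ∧
      ∀ x, x ≠ p₁ → x ≠ p₂ → e₁ x ≠ 0 ∧ e₂ x = (e₁ x)⁻¹ := by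
  obtain ⟨Ψ, h1, h2⟩ := exists_diffeo hp
  have hs : ∀ q : RiemannSphere, Ψ ⁻¹' {Ψ q}ᶜ = {q}ᶜ := fun q => by
    ext x
    simp
  refine ⟨_, diffeo_trans_mem Ψ coordZero_mem, _, diffeo_trans_mem Ψ coordInfty_mem,
    ?_, ?_, ?_, ?_, ?_, ?_, ?_⟩
  · rw [OpenPartialHomeomorph.trans_source, coordZero_source, ← h2]
    simpa using hs p₂
  · simp [coordZero_target]
  · change coordZero (Ψ p₁) = 0
    rw [h1, coordZero_coe]
  · rw [OpenPartialHomeomorph.trans_source, coordInfty_source, ← h1]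
    simpa using hs p₁
  · simp [coordInfty_target]
  · change coordInfty (Ψ p₂) = 0
    rw [h2, coordInfty_apply, inversionFun_infty, coordZero_coe]
  · intro x hx1 hx2
    change coordZero (Ψ x) ≠ 0 ∧ coordInfty (Ψ x) = (coordZero (Ψ x))⁻¹
    have hx1' : Ψ x ≠ ((0 : ℂ) : OnePoint ℂ) := fun h => hx1 (Ψ.injective (h.trans h1.symm))
    have hx2' : Ψ x ≠ OnePoint.infty := fun h => hx2 (Ψ.injective (h.trans h2.symm))
    generalize Ψ x = y at hx1' hx2'
    induction y using OnePoint.rec with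
    | infty => exact absurd rfl hx2'
    | coe z =>
      have hz : z ≠ 0 := fun h => hx1' (by rw [h])
      rw [coordInfty_apply, inversionFun_coe, if_neg hz, coordZero_coe, coordZero_coe]
      exact ⟨hz, rfl⟩

end RiemannSphere

/-! ### Weighted Hölder regularity -/

lemma exists_bound_iteratedFDeriv {V : ℝ → ℝ} {δ : ℝ}
    (hV : ∀ x ∈ Icc (-δ) δ, ContDiffAt ℝ ∞ V x) (l : ℕ) :
    ∃ M : ℝ, 0 ≤ M ∧ ∀ j ≤ l, ∀ x ∈ Icc (-δ) δ, ‖iteratedFDeriv ℝ j V x‖ ≤ M := by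
  have h : ∀ j : ℕ, ∃ M : ℝ, ∀ x ∈ Icc (-δ) δ, ‖iteratedFDeriv ℝ j V x‖ ≤ M := fun j => by
    refine isCompact_Icc.exists_bound_of_continuousOn fun x hx => ?_
    exact ((hV x hx).iteratedFDeriv_right (m := 0) (i := j)
      (by simpa using mod_cast le_top)).continuousAt.continuousWithinAt
  choose M hM using h
  refine ⟨∑ j ∈ Finset.range (l + 1), |M j|, Finset.sum_nonneg fun _ _ => abs_nonneg _,
    fun j hj x hx => (hM j x hx).trans ((le_abs_self _).trans ?_)⟩
  exact Finset.single_le_sum (f := fun j => |M j|) (fun _ _ => abs_nonneg _)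
    (Finset.mem_range.2 (by omega))

/-- Turns a Lipschitz bound into a Hölder bound on a range of s of length at most 2. -/
lemma le_two_mul_rpow {d α : ℝ} (hd : 0 ≤ d) (hd2 : d ≤ 2) (hα : 0 ≤ α) (hα1 : α ≤ 1) :
    d ≤ 2 * d ^ α := by
  have h1 : d / 2 ≤ (d / 2) ^ α := by
    have := Real.rpow_le_rpow_of_exponent_ge' (x := d / 2) (by positivity) (by linarith) hα hα1
    simpa using this
  have h2 : (d / 2) ^ α ≤ d ^ α := Real.rpow_le_rpow (by positivity) (by linarith) hα
  linarith

/-- Rescalings `s ↦ V (s / 2ᵏ)` of a smooth function are bounded in all Hölder spaces. -/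
lemma isWeightedHolder_of_rescaled {V : ℝ → ℝ} (hV : ∀ᶠ x in 𝓝 0, ContDiffAt ℝ ∞ V x) {b : ℝ}
    {u : ℂ → ℝ} (hu : ∀ k : ℕ, ∀ x ∈ Ioo (1 / 2 : ℝ) 2 ×ˢ (univ : Set ℝ),
      rescaled b u k x = V (x.1 / 2 ^ k)) (l : ℕ) {α : ℝ≥0} (hα : α ≤ 1) :
    IsWeightedHolder b l α u := by
  obtain ⟨ε, hε, hVε⟩ := Metric.eventually_nhds_iff_ball.1 hV
  set δ := ε / 2 with hδ
  have hδ0 : 0 < δ := by positivity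
  have hsub : Icc (-δ) δ ⊆ Metric.ball 0 ε := by
    intro x hx
    rw [Metric.mem_ball, dist_zero_right, Real.norm_eq_abs]
    exact (abs_le.2 hx).trans_lt (by linarith)
  -- One derivative beyond l is bounded to make the l-th one Lipschitz.
  obtain ⟨M, hM0, hM⟩ := exists_bound_iteratedFDeriv (fun x hx => hVε x (hsub hx)) (l + 1)
  have hlarge : ∀ᶠ k : ℕ in atTop, 2 / (2 : ℝ) ^ k < δ :=
    (tendsto_const_nhds.div_atTop (tendsto_pow_atTop_atTop_of_one_lt one_lt_two)).eventually_lt_const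
      hδ0
  lift M to ℝ≥0 using hM0
  refine ⟨2 * M, hlarge.mono fun k hk => ?_⟩
  set Ω : Set (ℝ × ℝ) := Ioo (1 / 2) 2 ×ˢ univ with hΩ
  have hΩo : IsOpen Ω := isOpen_Ioo.prod isOpen_univ
  -- The rescaled function is V ∘ L with ‖L‖ ≤ 1, so composition with L increases no derivative norm
  -- and the bounds are uniform in k.
  set L : ℝ × ℝ →L[ℝ] ℝ := ((2 : ℝ) ^ k)⁻¹ • ContinuousLinearMap.fst ℝ ℝ ℝ with hL
  have hL_apply : ∀ x : ℝ × ℝ, L x = x.1 / 2 ^ k := fun x => by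
    simp [hL, div_eq_inv_mul]
  have hk1 : ((2 : ℝ) ^ k)⁻¹ ≤ 1 := inv_le_one_of_one_le₀ (one_le_pow₀ one_le_two)
  have hLn : ‖L‖ ≤ 1 := by
    rw [hL, norm_smul]
    have h1 := ContinuousLinearMap.norm_fst_le (𝕜 := ℝ) (E := ℝ) (F := ℝ)
    have h2 : ‖((2 : ℝ) ^ k)⁻¹‖ ≤ 1 := by
      rw [Real.norm_of_nonneg (by positivity)]; exact hk1
    exact mul_le_one₀ h2 (norm_nonneg _) h1
  have hLm : ∀ x ∈ Ω, L x ∈ Icc (-δ) δ := fun x hx => by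
    have h1 := hx.1
    rw [hL_apply]
    have h2 : x.1 / 2 ^ k ≤ 2 / 2 ^ k := by gcongr; exact h1.2.le
    have h3 : 0 ≤ x.1 / 2 ^ k := div_nonneg (by linarith [h1.1]) (by positivity)
    exact ⟨by linarith, by linarith⟩
  have hcongr : ∀ x ∈ Ω, rescaled b u k =ᶠ[𝓝 x] V ∘ L := fun x hx => by
    filter_upwards [hΩo.mem_nhds hx] with y hy
    rw [hu k y hy, Function.comp, hL_apply]
  have hVs : ContDiffOn ℝ ∞ V (Metric.ball 0 ε) := fun x hx => (hVε x hx).contDiffWithinAt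
  have hD : ∀ x ∈ Ω, ∀ j : ℕ, iteratedFDeriv ℝ j (rescaled b u k) x
      = (iteratedFDeriv ℝ j V (L x)).compContinuousLinearMap fun _ => L := fun x hx j => by
    have ho : IsOpen (L ⁻¹' Metric.ball 0 ε) := Metric.isOpen_ball.preimage L.continuous
    have hm := hsub (hLm x hx)
    have h := L.iteratedFDerivWithin_comp_right hVs Metric.isOpen_ball.uniqueDiffOn
      ho.uniqueDiffOn (x := x) hm (i := j) (mod_cast le_top)
    rw [iteratedFDerivWithin_of_isOpen _ ho hm,
      iteratedFDerivWithin_of_isOpen _ Metric.isOpen_ball hm] at h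
    rw [((hcongr x hx).iteratedFDeriv ℝ j).self_of_nhds, h]
  have hcomp : ∀ (j : ℕ) (A : ContinuousMultilinearMap ℝ (fun _ : Fin j => ℝ) ℝ),
      ‖A.compContinuousLinearMap fun _ => L‖ ≤ ‖A‖ := fun j A => by
    refine (A.norm_compContinuousLinearMap_le _).trans ?_
    rw [Finset.prod_const]
    exact mul_le_of_le_one_right (norm_nonneg _) (pow_le_one₀ (norm_nonneg _) hLn)
  refine ⟨fun x hx => ?_, fun j hj x hx => ?_, fun x hx y hy => ?_⟩
  · have h1 : ContDiffAt ℝ ∞ (V ∘ L) x :=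
      (hVε _ (hsub (hLm x hx))).comp x L.contDiff.contDiffAt
    exact ((h1.of_le (mod_cast le_top)).congr_of_eventuallyEq (hcongr x hx)).contDiffWithinAt
  · rw [hD x hx]
    refine ((hcomp j _).trans (hM j (by omega) _ (hLm x hx))).trans ?_
    push_cast
    linarith [M.coe_nonneg]
  · have hlip : ‖iteratedFDeriv ℝ l V (L x) - iteratedFDeriv ℝ l V (L y)‖ ≤ M * ‖L x - L y‖ := by
      refine (convex_Icc (-δ) δ).norm_image_sub_le_of_norm_fderiv_le (𝕜 := ℝ) (fun w hw => ?_)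
        (fun w hw => ?_) (hLm y hy) (hLm x hx)
      · exact ((hVε w (hsub hw)).iteratedFDeriv_right (m := 1) (i := l)
          (mod_cast le_top)).differentiableAt (by simp)
      · rw [norm_fderiv_iteratedFDeriv]
        exact hM _ le_rfl w hw
    have hxy : ‖L x - L y‖ ≤ |x.1 - y.1| := by
      rw [hL_apply, hL_apply, ← sub_div, Real.norm_eq_abs, abs_div, div_eq_mul_inv]
      refine mul_le_of_le_one_right (abs_nonneg _) ?_
      rw [abs_of_pos (by positivity)]
      exact hk1
    have h2 : |x.1 - y.1| ≤ 2 := by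
      have := hx.1; have := hy.1
      rw [abs_le]
      constructor <;> linarith [hx.1.1, hx.1.2, hy.1.1, hy.1.2]
    have h3 : |x.1 - y.1| ≤ dist x y := by
      rw [← Real.dist_eq, Prod.dist_eq]
      exact le_max_left _ _
    have h4 := le_two_mul_rpow (abs_nonneg _) h2 α.coe_nonneg (NNReal.coe_le_coe.2 hα)
    have hmain : dist (iteratedFDeriv ℝ l (rescaled b u k) x)
        (iteratedFDeriv ℝ l (rescaled b u k) y) ≤ 2 * M * dist x y ^ (α : ℝ) := by
      rw [dist_eq_norm, hD x hx, hD y hy]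
      have h6 := hcomp l (iteratedFDeriv ℝ l V (L x) - iteratedFDeriv ℝ l V (L y))
      calc _ ≤ _ := h6
        _ ≤ M * ‖L x - L y‖ := hlip
        _ ≤ M * (2 * dist x y ^ (α : ℝ)) := by
          gcongr
          exact hxy.trans (h4.trans (by gcongr))
        _ = _ := by ring
    rw [edist_dist, edist_dist, ENNReal.ofReal_rpow_of_nonneg dist_nonneg α.coe_nonneg,
      ← ENNReal.ofReal_coe_nnreal, ← ENNReal.ofReal_mul (NNReal.coe_nonneg _)]
    push_cast
    exact ENNReal.ofReal_le_ofReal hmain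

/-- A smooth function of `|z|^(2 (b + 1))` is weighted Hölder near a cone point of order `b`. -/
lemma isWeightedHolder_comp_norm_rpow {U : ℝ → ℝ} (hU : ∀ᶠ x in 𝓝 0, ContDiffAt ℝ ∞ U x) {b : ℝ}
    (hb : -1 < b) (l : ℕ) {α : ℝ≥0} (hα : α ≤ 1) :
    IsWeightedHolder b l α fun z => U (‖z‖ ^ (2 * (b + 1))) := by
  have hb' : 0 < b + 1 := by linarith
  -- With y = s/2ᵏ one has r^(b+1) = (b + 1) y, hence r^(2(b+1)) = ((b + 1) y)².
  refine isWeightedHolder_of_rescaled (V := fun y => U (((b + 1) * y) ^ 2)) ?_ ?_ l hα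
  · have h0 : Tendsto (fun y : ℝ => ((b + 1) * y) ^ 2) (𝓝 0) (𝓝 0) := by
      have : Continuous fun y : ℝ => ((b + 1) * y) ^ 2 := by fun_prop
      simpa using this.tendsto 0
    filter_upwards [h0.eventually hU] with y hy
    exact hy.comp y (by fun_prop : ContDiff ℝ ∞ fun y : ℝ => ((b + 1) * y) ^ 2).contDiffAt
  · intro k x hx
    have hx1 : 0 < x.1 := by linarith [hx.1.1]
    have h1 : 0 ≤ (b + 1) * (x.1 / 2 ^ k) := by positivity
    rw [rescaled]
    congr 1
    rw [norm_mul, Complex.norm_exp_ofReal_mul_I, mul_one, Complex.norm_real,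
      Real.norm_of_nonneg (by positivity), ← Real.rpow_mul h1,
      show 1 / (b + 1) * (2 * (b + 1)) = (2 : ℕ) by push_cast; field_simp, Real.rpow_natCast]

/-! ### Gluing a conformal metric from two coordinates -/

section Gluing

lemma deriv_transition_self {S : Type*} [TopologicalSpace S]
    (e : OpenPartialHomeomorph S ℂ) {x : S} (hx : x ∈ e.source) :
    deriv (e ∘ e.symm) (e x) = 1 := by
  have h : e ∘ e.symm =ᶠ[𝓝 (e x)] id := by
    filter_upwards [e.open_target.mem_nhds (e.map_source hx)] with w hw
    simp [e.right_inv hw]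
  rw [h.deriv_eq, deriv_id]

variable {S : Type*} [TopologicalSpace S] [ChartedSpace ℂ S]

lemma analyticAt_transition {e e' : OpenPartialHomeomorph S ℂ} (he : e ∈ conformalCoordinates S)
    (he' : e' ∈ conformalCoordinates S) {x : S} (hx : x ∈ e.source) (hx' : x ∈ e'.source) :
    AnalyticAt ℂ (e' ∘ e.symm) (e x) := by
  have h := contMDiffOn_of_mem_contDiffGroupoid
    (StructureGroupoid.compatible_of_mem_maximalAtlas he he')
  rw [contMDiffOn_iff_contDiffOn] at h
  have hmem : e x ∈ (e.symm ≫ₕ e').source := by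
    simp [hx, hx']
  exact (h.contDiffAt ((e.symm ≫ₕ e').open_source.mem_nhds hmem)).analyticAt

lemma deriv_transition_comp {e e' e'' : OpenPartialHomeomorph S ℂ}
    (he : e ∈ conformalCoordinates S) (he' : e' ∈ conformalCoordinates S)
    (he'' : e'' ∈ conformalCoordinates S) {x : S} (hx : x ∈ e.source) (hx' : x ∈ e'.source)
    (hx'' : x ∈ e''.source) :
    deriv (e'' ∘ e.symm) (e x)
      = deriv (e'' ∘ e'.symm) (e' x) * deriv (e' ∘ e.symm) (e x) := by
  have h0 : (e' ∘ e.symm) (e x) = e' x := by simp [hx]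
  have h1 := (analyticAt_transition he he' hx hx').differentiableAt
  have h2 := (analyticAt_transition he' he'' hx' hx'').differentiableAt
  rw [← h0] at h2 ⊢
  rw [← deriv_comp _ h2 h1]
  apply EventuallyEq.deriv_eq
  have hn : e.target ∩ e.symm ⁻¹' e'.source ∈ 𝓝 (e x) :=
    (e.isOpen_inter_preimage_symm e'.open_source).mem_nhds ⟨e.map_source hx, by simpa [hx]⟩
  filter_upwards [hn] with w hw
  simp [e'.left_inv hw.2]

lemma deriv_transition_ne_zero {e e' : OpenPartialHomeomorph S ℂ}
    (he : e ∈ conformalCoordinates S) (he' : e' ∈ conformalCoordinates S) {x : S}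
    (hx : x ∈ e.source) (hx' : x ∈ e'.source) : deriv (e' ∘ e.symm) (e x) ≠ 0 := by
  have h := deriv_transition_comp he he' he hx hx' hx
  rw [deriv_transition_self e hx] at h
  exact fun h0 => one_ne_zero (h.trans (by rw [h0, mul_zero]))

open Classical in
-- In any coordinate the density is the pullback of h₁ or h₂. The chain rule for transition maps
-- gives compatibility everywhere off P, and `hcompat` makes the two choices agree on the overlap.
lemma exists_conformalMetric {P : Set S} {e₁ e₂ : OpenPartialHomeomorph S ℂ}
    (he₁ : e₁ ∈ conformalCoordinates S) (he₂ : e₂ ∈ conformalCoordinates S)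
    (hcov : ∀ x, x ∈ e₁.source ∨ x ∈ e₂.source) {h₁ h₂ : ℂ → ℝ}
    (hpos₁ : ∀ x ∈ e₁.source, x ∉ P → 0 < h₁ (e₁ x))
    (hpos₂ : ∀ x ∈ e₂.source, x ∉ P → 0 < h₂ (e₂ x))
    (hsm₁ : ∀ x ∈ e₁.source, x ∉ P → ContDiffAt ℝ ∞ h₁ (e₁ x))
    (hsm₂ : ∀ x ∈ e₂.source, x ∉ P → ContDiffAt ℝ ∞ h₂ (e₂ x))
    (hcompat : ∀ x ∈ e₁.source ∩ e₂.source, x ∉ P →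
      h₁ (e₁ x) = h₂ (e₂ x) * ‖deriv (e₂ ∘ e₁.symm) (e₁ x)‖ ^ 2) :
    ∃ g : ConformalMetric S P, ∀ e ∈ conformalCoordinates S, ∀ x ∈ e.source, x ∉ P →
      (x ∈ e₁.source → g.density e (e x) = h₁ (e₁ x) * ‖deriv (e₁ ∘ e.symm) (e x)‖ ^ 2) ∧
      (x ∈ e₂.source → g.density e (e x) = h₂ (e₂ x) * ‖deriv (e₂ ∘ e.symm) (e x)‖ ^ 2) := by
  set D : OpenPartialHomeomorph S ℂ → ℂ → ℝ := fun e z =>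
    if e.symm z ∈ e₁.source then h₁ (e₁ (e.symm z)) * ‖deriv (e₁ ∘ e.symm) z‖ ^ 2
    else h₂ (e₂ (e.symm z)) * ‖deriv (e₂ ∘ e.symm) z‖ ^ 2 with hD
  have hD₁ : ∀ e ∈ conformalCoordinates S, ∀ x ∈ e.source, x ∈ e₁.source →
      D e (e x) = h₁ (e₁ x) * ‖deriv (e₁ ∘ e.symm) (e x)‖ ^ 2 := fun e _ x hx hx₁ => by
    simp [hD, hx, hx₁]
  have hD₂ : ∀ e ∈ conformalCoordinates S, ∀ x ∈ e.source, x ∉ P → x ∈ e₂.source →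
      D e (e x) = h₂ (e₂ x) * ‖deriv (e₂ ∘ e.symm) (e x)‖ ^ 2 := fun e he x hx hxP hx₂ => by
    by_cases hx₁ : x ∈ e₁.source
    · rw [hD₁ e he x hx hx₁, hcompat x ⟨hx₁, hx₂⟩ hxP,
        deriv_transition_comp he he₁ he₂ hx hx₁ hx₂, norm_mul]
      ring
    · simp [hD, hx, hx₁]
  have hdpos : ∀ e ∈ conformalCoordinates S, ∀ e' ∈ conformalCoordinates S, ∀ x ∈ e.source,
      x ∈ e'.source → 0 < ‖deriv (e' ∘ e.symm) (e x)‖ ^ 2 := fun e he e' he' x hx hx' => by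
    have := deriv_transition_ne_zero he he' hx hx'
    positivity
  have hsmooth : ∀ e ∈ conformalCoordinates S, ∀ e' ∈ conformalCoordinates S, ∀ h : ℂ → ℝ,
      ∀ x ∈ e.source, x ∈ e'.source → ContDiffAt ℝ ∞ h (e' x) →
      (∀ y ∈ e.source, y ∉ P → y ∈ e'.source →
        D e (e y) = h (e' y) * ‖deriv (e' ∘ e.symm) (e y)‖ ^ 2) → x ∉ P →
      ContDiffWithinAt ℝ ∞ (D e) (e.target ∩ e.symm ⁻¹' Pᶜ) (e x) := by
    intro e he e' he' h x hx hx' hh hDe hxP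
    have hT := analyticAt_transition he he' hx hx'
    have h0 : (e' ∘ e.symm) (e x) = e' x := by simp [hx]
    have h1 : ContDiffAt ℝ ∞ (fun w => h ((e' ∘ e.symm) w) * ‖deriv (e' ∘ e.symm) w‖ ^ 2) (e x) := by
      have hT' : ContDiffAt ℝ ∞ (e' ∘ e.symm) (e x) := hT.contDiffAt.restrict_scalars ℝ
      have hdT : ContDiffAt ℝ ∞ (deriv (e' ∘ e.symm)) (e x) :=
        hT.deriv.contDiffAt.restrict_scalars ℝ
      rw [← h0] at hh
      exact (hh.comp (e x) hT').mul (hdT.norm_sq ℝ)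
    refine h1.contDiffWithinAt.congr_of_eventuallyEq ?_ ?_
    · have hn : e.symm ⁻¹' e'.source ∈ 𝓝 (e x) :=
        (e.continuousAt_symm (e.map_source hx)).preimage_mem_nhds
          (e'.open_source.mem_nhds (by simpa [hx]))
      filter_upwards [mem_nhdsWithin_of_mem_nhds hn, self_mem_nhdsWithin] with w hw hw'
      have := hDe (e.symm w) (e.map_target hw'.1) hw'.2 hw
      rwa [e.right_inv hw'.1] at this
    · rw [hDe x hx hxP hx', h0]
  refine ⟨⟨D, ?_, ?_, ?_⟩, fun e he x hx hxP => ⟨hD₁ e he x hx, hD₂ e he x hx hxP⟩⟩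
  · rintro e he z ⟨hz, hzP⟩
    have hx := e.map_target hz
    rw [← e.right_inv hz]
    rcases hcov (e.symm z) with h | h
    · rw [hD₁ e he _ hx h]
      exact mul_pos (hpos₁ _ h hzP) (hdpos e he e₁ he₁ _ hx h)
    · rw [hD₂ e he _ hx hzP h]
      exact mul_pos (hpos₂ _ h hzP) (hdpos e he e₂ he₂ _ hx h)
  · rintro e he z ⟨hz, hzP⟩
    have hx := e.map_target hz
    have key := fun e' he' h => hsmooth e he e' he' h _ hx
    rw [e.right_inv hz] at key
    rcases hcov (e.symm z) with h | h
    · exact key e₁ he₁ h₁ h (hsm₁ _ h hzP) (fun y hy _ => hD₁ e he y hy) hzP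
    · exact key e₂ he₂ h₂ h (hsm₂ _ h hzP) (fun y hy => hD₂ e he y hy) hzP
  · rintro e he e' he' x ⟨hx, hx'⟩ hxP
    rcases hcov x with h | h
    · rw [hD₁ e he x hx h, hD₁ e' he' x hx' h, deriv_transition_comp he he' he₁ hx hx' h, norm_mul]
      ring
    · rw [hD₂ e he x hx hxP h, hD₂ e' he' x hx' hxP h,
        deriv_transition_comp he he' he₂ hx hx' h, norm_mul]
      ring

end Gluing

/-! ### The metric near its two poles -/

namespace SolitonProfile

/-- The density of the soliton metric in a coordinate centred at a pole of order `l`. -/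
def endDensity (l : ℝ) (H : ℝ → ℝ) (z : ℂ) : ℝ :=
  ‖z‖ ^ (2 * l) * H (‖z‖ ^ (2 * (l + 1)))

/-- The origin is admitted only for l = 0, the case of a pole outside the support: the powers are
then 1 and |z|². -/
lemma contDiffAt_norm_rpow {l : ℝ} {z : ℂ} (hz : z = 0 → l = 0) :
    ContDiffAt ℝ ∞ (fun z : ℂ => ‖z‖ ^ (2 * l)) z ∧
      ContDiffAt ℝ ∞ (fun z : ℂ => ‖z‖ ^ (2 * (l + 1))) z := by
  by_cases h : z = 0
  · rw [hz h]
    refine ⟨by simpa using contDiffAt_const, ?_⟩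
    have : (fun z : ℂ => ‖z‖ ^ (2 * ((0 : ℝ) + 1))) = fun z => ‖z‖ ^ 2 := by
      funext z
      rw [show 2 * ((0 : ℝ) + 1) = (2 : ℕ) by norm_num, Real.rpow_natCast]
    rw [this]
    exact (contDiff_norm_sq ℝ).contDiffAt
  · have h1 : ContDiffAt ℝ ∞ (fun z : ℂ => ‖z‖) z := contDiffAt_norm ℝ h
    have h2 : ‖z‖ ≠ 0 := norm_ne_zero_iff.2 h
    exact ⟨h1.rpow_const_of_ne h2, h1.rpow_const_of_ne h2⟩

lemma exp_mul_log_norm {z : ℂ} (hz : z ≠ 0) (a : ℝ) :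
    Real.exp (2 * a * Real.log ‖z‖) = ‖z‖ ^ (2 * a) := by
  rw [Real.rpow_def_of_pos (norm_pos_iff.2 hz), mul_comm]

variable {l : ℝ} {Φ X Y H : ℝ → ℝ} {O : Set ℝ}

namespace IsEnd

lemma norm_rpow_mem {a : ℝ} (h : IsEnd a Φ X Y H O) (z : ℂ) (q : ℝ) : ‖z‖ ^ q ∈ O :=
  h.Ici_subset (Real.rpow_nonneg (norm_nonneg z) _)

lemma endDensity_pos (h : IsEnd (l + 1) Φ X Y H O) {z : ℂ} (hz : z = 0 → l = 0) :
    0 < endDensity l H z := by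
  refine mul_pos ?_ (h.pos _ (h.norm_rpow_mem _ _))
  by_cases h0 : z = 0
  · simp [hz h0]
  · exact Real.rpow_pos_of_pos (norm_pos_iff.2 h0) _

lemma contDiffAt_endDensity (h : IsEnd (l + 1) Φ X Y H O) {z : ℂ} (hz : z = 0 → l = 0) :
    ContDiffAt ℝ ∞ (endDensity l H) z :=
  (contDiffAt_norm_rpow hz).1.mul (ContDiffAt.comp z
    (h.contDiffOn_H.contDiffAt (h.isOpen.mem_nhds (h.norm_rpow_mem _ _)))
    (contDiffAt_norm_rpow hz).2)

lemma contDiffAt_potential (h : IsEnd (l + 1) Φ X Y H O) {z : ℂ} (hz : z = 0 → l = 0) :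
    ContDiffAt ℝ ∞ (fun z : ℂ => Y (‖z‖ ^ (2 * (l + 1)))) z :=
  ContDiffAt.comp z (h.contDiffOn_Y.contDiffAt (h.isOpen.mem_nhds (h.norm_rpow_mem _ _)))
    (contDiffAt_norm_rpow hz).2

lemma continuous_norm_rpow_comp {a : ℝ} (ha : 0 ≤ a) (h : IsEnd a Φ X Y H O) {F : ℝ → ℝ}
    (hF : ContinuousOn F O) : Continuous fun z : ℂ => F (‖z‖ ^ (2 * a)) :=
  hF.comp_continuous (continuous_norm.rpow_const fun _ => Or.inr (by positivity))
    fun z => h.norm_rpow_mem _ _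

/-- This is the density relative to |dz/z|², a form invariant under z ↦ 1/z, so the expressions at
the two poles can be compared. -/
lemma endDensity_mul_norm_sq (h : IsEnd (l + 1) Φ X Y H O) {z : ℂ} (hz : z ≠ 0) :
    endDensity l H z * ‖z‖ ^ 2 = Φ (X (Real.log ‖z‖)) := by
  have hn := norm_pos_iff.2 hz
  have h1 : ‖z‖ ^ (2 * (l + 1)) = ‖z‖ ^ (2 * l) * ‖z‖ ^ 2 := by
    rw [← Real.rpow_natCast, ← Real.rpow_add hn]
    congr 1
    push_cast
    ring
  rw [h.Φ_eq, exp_mul_log_norm hz, endDensity, h1]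
  ring

lemma potential_eq {a : ℝ} (h : IsEnd a Φ X Y H O) {z : ℂ} (hz : z ≠ 0) :
    Y (‖z‖ ^ (2 * a)) = X (Real.log ‖z‖) := by
  rw [h.X_eq, exp_mul_log_norm hz]

variable {S : Type*} [TopologicalSpace S] [ChartedSpace ℂ S] {P : Set S}

lemma hasConicalSingularity (h : IsEnd (l + 1) Φ X Y H O) (hl : -1 < l) {g : ConformalMetric S P}
    {p : S} {e : OpenPartialHomeomorph S ℂ} (he : e ∈ conformalCoordinates S) (hp : p ∈ e.source)
    (h0 : e p = 0) (ht : e.target = univ) (hg : ∀ z ≠ 0, g.density e z = endDensity l H z) :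
    g.HasConicalSingularity p l := by
  refine ⟨e, he, hp, h0, fun z => H (‖z‖ ^ (2 * (l + 1))), univ, univ_mem, by rw [ht],
    (h.continuous_norm_rpow_comp (by linarith) h.contDiffOn_H.continuousOn).continuousOn,
    fun z _ => h.pos _ (h.norm_rpow_mem _ _), fun z _ hz => ?_⟩
  rw [hg z hz, endDensity, mul_comm]

lemma isHolderConeAt (h : IsEnd (l + 1) Φ X Y H O) (hl : -1 < l) {g : ConformalMetric S P}
    {p : S} {e : OpenPartialHomeomorph S ℂ} (he : e ∈ conformalCoordinates S) (hp : p ∈ e.source)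
    (h0 : e p = 0) (hg : ∀ z ≠ 0, g.density e z = endDensity l H z) (k : ℕ) {α : ℝ≥0}
    (hα : α ≤ 1) : g.IsHolderConeAt p l k α := by
  refine ⟨e, he, hp, h0, fun z => (1 / 2) * Real.log (H (‖z‖ ^ (2 * (l + 1)))),
    isWeightedHolder_comp_norm_rpow (U := fun w => (1 / 2) * Real.log (H w)) ?_ hl k hα, ?_⟩
  · filter_upwards [h.isOpen.mem_nhds (h.Ici_subset (mem_Ici.2 le_rfl))] with w hw
    exact contDiffAt_const.mul
      ((h.contDiffOn_H.contDiffAt (h.isOpen.mem_nhds hw)).log (h.pos w hw).ne')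
  · filter_upwards [self_mem_nhdsWithin] with z hz
    rw [hg z hz, endDensity, ← mul_assoc, mul_one_div_cancel two_ne_zero, one_mul,
      Real.exp_log (h.pos _ (h.norm_rpow_mem _ _)), mul_comm]

end IsEnd

end SolitonProfile

/-! ### Assembly of the metric and its potential -/

open SolitonProfile in
theorem mainTheorem4 (p₁ p₂ : RiemannSphere) (hp : p₁ ≠ p₂) (l₁ l₂ : ℝ)
    (hl₁ : -1 < l₁) (hl₂ : -1 < l₂) :
    ∃ g : ConformalMetric RiemannSphere
        ((Finsupp.single p₁ l₁ + Finsupp.single p₂ l₂).support : Set RiemannSphere),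
      g.InConformalClass (Finsupp.single p₁ l₁ + Finsupp.single p₂ l₂) ∧
      g.IsGradientSoliton 1 ∧
      g.IsRotationallySymmetric p₁ p₂ := by
  set β := Finsupp.single p₁ l₁ + Finsupp.single p₂ l₂ with hβ
  have hβ₁ : β p₁ = l₁ := by simp [hβ, hp.symm]
  have hβ₂ : β p₂ = l₂ := by simp [hβ, hp]
  have hβ₀ : ∀ x, x ≠ p₁ → x ≠ p₂ → x ∉ (β.support : Set RiemannSphere) := fun x h1 h2 => by
    simp [hβ, h1.symm, h2.symm]
  obtain ⟨e₁, he₁, e₂, he₂, hs₁, ht₁, h0₁, hs₂, ht₂, h0₂, hinv⟩ :=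
    RiemannSphere.exists_coordinates hp
  have hmem₁ : ∀ {x}, x ∈ e₁.source ↔ x ≠ p₂ := fun {x} => by simp [hs₁]
  have hmem₂ : ∀ {x}, x ∈ e₂.source ↔ x ≠ p₁ := fun {x} => by simp [hs₂]
  have hzero₁ : ∀ x ∈ e₁.source, e₁ x = 0 → x = p₁ := fun x hx h =>
    e₁.injOn hx (hmem₁.2 hp) (h.trans h0₁.symm)
  have hzero₂ : ∀ x ∈ e₂.source, e₂ x = 0 → x = p₂ := fun x hx h =>
    e₂.injOn hx (hmem₂.2 hp.symm) (h.trans h0₂.symm)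
  have hP₁ : ∀ x ∈ e₁.source, x ∉ (β.support : Set RiemannSphere) → e₁ x = 0 → l₁ = 0 :=
    fun x hx hxP h => by
      rw [hzero₁ x hx h] at hxP
      simpa [hβ₁] using hxP
  have hP₂ : ∀ x ∈ e₂.source, x ∉ (β.support : Set RiemannSphere) → e₂ x = 0 → l₂ = 0 :=
    fun x hx hxP h => by
      rw [hzero₂ x hx h] at hxP
      simpa [hβ₂] using hxP
  have hcov : ∀ x, x ∈ e₁.source ∨ x ∈ e₂.source := fun x => by
    rw [hmem₁, hmem₂]
    by_contra! h
    exact hp (h.2.symm.trans h.1)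
  obtain ⟨c, Φ, X, Y₁, H₁, O₁, Y₂, H₂, O₂, hΦ, hX, E₁, E₂⟩ :=
    exists_profile (show 0 < l₁ + 1 by linarith) (show 0 < l₂ + 1 by linarith)
  have hΦpos : ∀ t, 0 < Φ (X t) := fun t => by
    rw [E₁.Φ_eq]
    exact mul_pos (Real.exp_pos _) (E₁.pos _ (E₁.Ici_subset (Real.exp_pos _).le))
  have hlog : ∀ z : ℂ, -Real.log ‖z⁻¹‖ = Real.log ‖z‖ := fun z => by
    rw [norm_inv, Real.log_inv, neg_neg]
  obtain ⟨g, hg⟩ := exists_conformalMetric (P := (β.support : Set RiemannSphere)) he₁ he₂ hcov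
    (h₁ := endDensity l₁ H₁) (h₂ := endDensity l₂ H₂)
    (fun x hx hxP => E₁.endDensity_pos (hP₁ x hx hxP))
    (fun x hx hxP => E₂.endDensity_pos (hP₂ x hx hxP))
    (fun x hx hxP => E₁.contDiffAt_endDensity (hP₁ x hx hxP))
    (fun x hx hxP => E₂.contDiffAt_endDensity (hP₂ x hx hxP))
    -- The transition is w ↦ 1/w; relative to |dz/z|² both densities equal Φ(X(log |z|)).
    (by
      rintro x ⟨hx₁, hx₂⟩ -
      obtain ⟨hz, hzi⟩ := hinv x (hmem₂.1 hx₂) (hmem₁.1 hx₁)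
      have hT : e₂ ∘ e₁.symm =ᶠ[𝓝 (e₁ x)] fun w => w⁻¹ := by
        filter_upwards [(isOpen_ne (x := (0 : ℂ))).mem_nhds hz] with w hw
        have hwt : w ∈ e₁.target := by rw [ht₁]; trivial
        have hws := e₁.map_target hwt
        have hwr := e₁.right_inv hwt
        have := hinv (e₁.symm w) (fun h => hw (by rw [← hwr, h, h0₁])) (hmem₁.1 hws)
        rw [hwr] at this
        exact this.2
      rw [hT.deriv_eq, deriv_inv]
      have e1 := E₁.endDensity_mul_norm_sq hz
      have e2 := E₂.endDensity_mul_norm_sq (inv_ne_zero hz)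
      rw [neg_neg, hlog, ← e1] at e2
      rw [hzi]
      have hn : ‖e₁ x‖ ≠ 0 := norm_ne_zero_iff.2 hz
      rw [norm_inv] at e2
      rw [norm_neg, norm_inv, norm_pow]
      field_simp at e2 ⊢
      linarith)
  have hg₁ : ∀ z ≠ 0, g.density e₁ z = endDensity l₁ H₁ z := fun z hz => by
    have hzt : z ∈ e₁.target := by rw [ht₁]; trivial
    have hzs := e₁.map_target hzt
    have hzr := e₁.right_inv hzt
    have h := (hg e₁ he₁ _ hzs (hβ₀ _ (fun h => hz (by rw [← hzr, h, h0₁])) (hmem₁.1 hzs))).1 hzs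
    rwa [deriv_transition_self e₁ hzs, hzr, norm_one, one_pow, mul_one] at h
  have hg₂ : ∀ z ≠ 0, g.density e₂ z = endDensity l₂ H₂ z := fun z hz => by
    have hzt : z ∈ e₂.target := by rw [ht₂]; trivial
    have hzs := e₂.map_target hzt
    have hzr := e₂.right_inv hzt
    have h := (hg e₂ he₂ _ hzs (hβ₀ _ (hmem₂.1 hzs) (fun h => hz (by rw [← hzr, h, h0₂])))).2 hzs
    rwa [deriv_transition_self e₂ hzs, hzr, norm_one, one_pow, mul_one] at h
  refine ⟨g, ⟨rfl, fun p hpβ => ?_⟩, ?_, ⟨e₁, he₁, hs₁, ht₁, h0₁, fun z w hz hzw => ?_⟩⟩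
  · by_cases h1 : p = p₁
    · subst h1
      rw [hβ₁]
      exact ⟨E₁.hasConicalSingularity hl₁ he₁ (hmem₁.2 hp) h0₁ ht₁ hg₁, fun l α _ hα =>
        E₁.isHolderConeAt hl₁ he₁ (hmem₁.2 hp) h0₁ hg₁ l hα.le⟩
    by_cases h2 : p = p₂
    · subst h2
      rw [hβ₂]
      exact ⟨E₂.hasConicalSingularity hl₂ he₂ (hmem₂.2 hp.symm) h0₂ ht₂ hg₂, fun l α _ hα =>
        E₂.isHolderConeAt hl₂ he₂ (hmem₂.2 hp.symm) h0₂ hg₂ l hα.le⟩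
    exact absurd hpβ (hβ₀ p h1 h2)
  · classical
    set f₁ : ℂ → ℝ := fun z => c * Y₁ (‖z‖ ^ (2 * (l₁ + 1))) with hf₁
    -- The sign compensates the reversed moment map -X(-t) at the second pole.
    set f₂ : ℂ → ℝ := fun z => -(c * Y₂ (‖z‖ ^ (2 * (l₂ + 1)))) with hf₂
    set f : RiemannSphere → ℝ := fun x => if x ∈ e₁.source then f₁ (e₁ x) else f₂ (e₂ x) with hf
    have hfe₁ : ∀ x ∈ e₁.source, f x = f₁ (e₁ x) := fun x hx => if_pos hx
    have hfe₂ : ∀ x ∈ e₂.source, f x = f₂ (e₂ x) := fun x hx => by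
      by_cases hx₁ : x ∈ e₁.source
      · obtain ⟨hz, hzi⟩ := hinv x (hmem₂.1 hx) (hmem₁.1 hx₁)
        rw [hfe₁ x hx₁, hf₁, hf₂, hzi]
        simp only
        rw [E₁.potential_eq hz, E₂.potential_eq (inv_ne_zero hz), hlog, mul_neg, neg_neg]
      · exact if_neg hx₁
    have hcont₁ : Continuous f₁ := continuous_const.mul
      (E₁.continuous_norm_rpow_comp (by linarith) E₁.contDiffOn_Y.continuousOn)
    have hcont₂ : Continuous f₂ := (continuous_const.mul
      (E₂.continuous_norm_rpow_comp (by linarith) E₂.contDiffOn_Y.continuousOn)).neg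
    have hfcont : Continuous f := continuous_iff_continuousAt.2 fun x => by
      rcases hcov x with h | h
      · exact (hcont₁.continuousAt.comp (e₁.continuousAt h)).congr
          (by filter_upwards [e₁.open_source.mem_nhds h] with y hy using (hfe₁ y hy).symm)
      · exact (hcont₂.continuousAt.comp (e₂.continuousAt h)).congr
          (by filter_upwards [e₂.open_source.mem_nhds h] with y hy using (hfe₂ y hy).symm)
    refine ⟨f, hfcont, fun e he => ?_⟩
    have hsymm : ∀ {z}, z ∈ e.target → ∀ {U : Set RiemannSphere}, IsOpen U → e.symm z ∈ U →
        ∀ᶠ w in 𝓝 z, e.symm w ∈ U := fun hz _ hU hzU =>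
      (e.continuousAt_symm hz).preimage_mem_nhds (hU.mem_nhds hzU)
    have hfsm : ContDiffOn ℝ ∞ (f ∘ e.symm)
        (e.target ∩ e.symm ⁻¹' (β.support : Set RiemannSphere)ᶜ) := by
      rintro z ⟨hz, hzP⟩
      have hx := e.map_target hz
      have key : ∀ e' ∈ conformalCoordinates RiemannSphere, ∀ F : ℂ → ℝ,
          e.symm z ∈ e'.source → ContDiffAt ℝ ∞ F (e' (e.symm z)) →
          (∀ x ∈ e'.source, f x = F (e' x)) → ContDiffAt ℝ ∞ (f ∘ e.symm) z := by
        intro e' he' F hx' hF hfF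
        have hT : ContDiffAt ℝ ∞ (e' ∘ e.symm) z := by
          have := analyticAt_transition he he' hx hx'
          rw [e.right_inv hz] at this
          exact this.contDiffAt.restrict_scalars ℝ
        refine (ContDiffAt.comp z hF hT).congr_of_eventuallyEq ?_
        filter_upwards [hsymm hz e'.open_source hx'] with w hw using hfF _ hw
      refine ContDiffAt.contDiffWithinAt ?_
      rcases hcov (e.symm z) with h | h
      · exact key e₁ he₁ f₁ h
          (contDiffAt_const.mul (E₁.contDiffAt_potential (hP₁ _ h hzP))) hfe₁
      · exact key e₂ he₂ f₂ h
          (contDiffAt_const.mul (E₂.contDiffAt_potential (hP₂ _ h hzP))).neg hfe₂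
    refine ⟨hfsm, fun z hz i j => ?_⟩
    -- A pole with λᵢ = 0 lies in the domain of the equation, but log |e₁| is singular or undefined
    -- there. The equation is proved on a punctured neighbourhood avoiding both poles and extended
    -- by continuity.
    refine LocalGeometry.soliton_equation_of_punctured (e.isOpen_inter_preimage_symm
      (Finset.finite_toSet _).isClosed.isOpen_compl) hz (g.smooth e he)
      (fun w hw => (g.pos e he w hw).ne') hfsm i j ?_
    have hne : ∀ p, ∀ᶠ w in 𝓝[≠] z, e.symm w ≠ p := fun p => by
      by_cases hzp : e.symm z = p
      · filter_upwards [self_mem_nhdsWithin,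
          mem_nhdsWithin_of_mem_nhds (e.open_target.mem_nhds hz.1)] with w hw hwt h
        exact hw (e.symm.injOn hwt hz.1 (h.trans hzp.symm))
      · exact (hsymm hz.1 isOpen_ne hzp).filter_mono nhdsWithin_le_nhds
    filter_upwards [hne p₁, hne p₂, mem_nhdsWithin_of_mem_nhds (e.open_target.mem_nhds hz.1)]
      with w hw₁ hw₂ hwt
    have hx := e.map_target hwt
    have hx₁ : e.symm w ∈ e₁.source := hmem₁.2 hw₂
    have hT := analyticAt_transition he he₁ hx hx₁
    have hT1 := deriv_transition_ne_zero he he₁ hx hx₁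
    rw [e.right_inv hwt] at hT hT1
    have hnear : ∀ᶠ v in 𝓝 w, v ∈ e.target ∧ e.symm v ≠ p₁ ∧ e.symm v ≠ p₂ := by
      filter_upwards [e.open_target.mem_nhds hwt, hsymm hwt isOpen_ne hw₁,
        hsymm hwt isOpen_ne hw₂] with v h1 h2 h3 using ⟨h1, h2, h3⟩
    refine LocalGeometry.soliton_equation hΦ hX hΦpos hT (hinv _ hw₁ hw₂).1 hT1 ?_ ?_ i j
    · filter_upwards [hnear] with v hv
      have hv0 := (hinv _ hv.2.1 hv.2.2).1
      have h := (hg e he _ (e.map_target hv.1) (hβ₀ _ hv.2.1 hv.2.2)).1 (hmem₁.2 hv.2.2)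
      rw [e.right_inv hv.1] at h
      rw [h, Function.comp_apply, ← E₁.endDensity_mul_norm_sq hv0, Complex.normSq_eq_norm_sq,
        norm_div, div_pow]
      have := norm_ne_zero_iff.2 hv0
      field_simp
    · filter_upwards [hnear] with v hv
      rw [Function.comp_apply, Function.comp_apply, hfe₁ _ (hmem₁.2 hv.2.2), hf₁]
      simp only
      rw [E₁.potential_eq (hinv _ hv.2.1 hv.2.2).1]
  · have hw : w ≠ 0 := by
      rw [← norm_ne_zero_iff, ← hzw]
      exact norm_ne_zero_iff.2 hz
    rw [hg₁ z hz, hg₁ w hw, endDensity, endDensity, hzw]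

end
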